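/- Let $H\in(0,1)$, $\varepsilon\in(0,H)$, $T>0$, and let $c>0$ be any constant. For $0<s<t\le T$ let \[ K_H(t,s)=c\,s^{\frac12-H}\Bigl(t^{H-\frac12}(t-s)^{H-\frac12}-\bigl(H-\tfrac12\bigr)\int_s^t u^{H-\frac32}(u-s)^{H-\frac12}\,du\Bigr) \] be the Molchan–Golosov kernel, and let $Y^H_t=\int_0^t K_H(t,s)\,dZ_s$, $t\in[0,T]$, where, for each $t$, the integral of a deterministic function is understood as a limit in probability of the elementary integrals of step functions that converge to the integrand almost everywhere on $[0,t]$ (so $Y^H_t$ is defined up to a null set). 1. Let $Z$ be a Lévy process with characteristic triplet $(a,0,\pi)$, that is, $\mathbf E e^{i\mu Z_t}=\exp\bigl\{t\bigl(-\tfrac{a\mu^2}{2}+\int_{\mathbb R}(e^{i\mu x}-1-i\mu\tau(x))\,\pi(dx)\bigr)\bigr\}$ with $\tau(x)=x$ for $|x|\le1$ and $\tau(x)=x/|x|$ for $|x|>1$, where $a\ge0$ and the Lévy measure $\pi$ is symmetric with $0<\int_{\mathbb R}x^2\,\pi(dx)<\infty$. Then the process $Y^H$ exists, and there is a constant $C>0$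 such that for all $0\le s<t\le T$, \[ \mathbf E|Y^H_t-Y^H_s|^2\le C(t-s)^{2(H-\varepsilon)}. \] If moreover $H\in(\frac12,1)$, then $Y^H$ has a modification whose trajectories are $\varkappa$-Hölder continuous on $[0,T]$ for every $\varkappa\in(0,H-\frac12)$. 2. Let $Z$ be a Brownian motion. Then the process $Y^H$ exists, for every real $p\ge2$ there is a constant $C>0$ such that for all $0\le s<t\le T$, \[ \mathbf E|Y^H_t-Y^H_s|^p\le C(t-s)^{p(H-\varepsilon)}, \] and $Y^H$ has a modification whose trajectories are $\varkappa$-Hölder continuous on $[0,T]$ for every $\varkappa\in(0,H)$. -/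

import Mathlib

open MeasureTheory ProbabilityTheory Filter Topology Set
open scoped NNReal ENNReal

noncomputable section

/-! ### Lévy processes and their characteristic triplets -/

/-- A real-valued Lévy process `Z = (Z_t)_{t ≥ 0}`: it starts at `0`, has independent and
stationary increments, is stochastically continuous and has càdlàg paths almost surely. -/
structure IsLevyProcess {Ω : Type*} [MeasurableSpace Ω] (Z : ℝ≥0 → Ω → ℝ) (P : Measure Ω) :
    Prop where
  aemeasurable : ∀ t, AEMeasurable (Z t) P
  zero : ∀ᵐ ω ∂P, Z 0 ω = 0
  indepIncrements : HasIndepIncrements Z P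
  stationaryIncrements : ∀ s h : ℝ≥0, IdentDistrib (fun ω => Z (s + h) ω - Z s ω) (Z h) P P
  stochContinuous : ∀ t : ℝ≥0, TendstoInMeasure P Z (𝓝 t) (Z t)
  cadlag : ∀ᵐ ω ∂P, ∀ t : ℝ≥0, ContinuousWithinAt (fun s => Z s ω) (Ici t) t ∧
    ∃ l : ℝ, Tendsto (fun s => Z s ω) (𝓝[<] t) (𝓝 l)

/-- A Lévy measure on `ℝ`: a σ-finite Borel measure without mass at `0` that integrates
`x ^ 2 ∧ 1`. -/
structure IsLevyMeasure (π : Measure ℝ) : Prop where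
  sigmaFinite : SigmaFinite π
  zero : π {0} = 0
  lintegral_lt_top : ∫⁻ x, ENNReal.ofReal (min (x ^ 2) 1) ∂π < ∞

/-- The truncation function `τ(z) = z` for `|z| ≤ 1` and `τ(z) = z / |z|` for `|z| > 1`. -/
def levyTruncation (z : ℝ) : ℝ := if |z| ≤ 1 then z else z / |z|

/-- The characteristic exponent
`Ψ(μ) = i b μ - a μ² / 2 + ∫ (e^{i μ x} - 1 - i μ τ(x)) π(dx)`. -/
def levyExponent (a b : ℝ) (π : Measure ℝ) (μ : ℝ) : ℂ :=
  Complex.I * b * μ - a * μ ^ 2 / 2 +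
    ∫ x : ℝ, (Complex.exp (Complex.I * μ * x) - 1 - Complex.I * μ * levyTruncation x) ∂π

/-- `(a, b, π)` is the characteristic triplet of `Z`: `a ≥ 0`, `π` is a Lévy measure and
`E exp (i μ Z_t) = exp (t Ψ(μ))` for all `t ≥ 0` and all real `μ`. -/
structure HasCharacteristicTriplet {Ω : Type*} [MeasurableSpace Ω] (Z : ℝ≥0 → Ω → ℝ)
    (P : Measure Ω) (a b : ℝ) (π : Measure ℝ) : Prop where
  nonneg : 0 ≤ a
  isLevyMeasure : IsLevyMeasure π
  charFun_eq : ∀ (t : ℝ≥0) (μ : ℝ),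
    charFun (P.map (Z t)) μ = Complex.exp ((t : ℝ) * levyExponent a b π μ)

/-! ### The integral of a deterministic function with respect to a process -/

/-- A step function `∑_{k < n} coef k · 1_{(pt k, pt (k+1)]}` on the half-line, given by a
nondecreasing sequence of partition points and by its coefficients. -/
structure StepFunction where
  n : ℕ
  pt : ℕ → ℝ≥0
  mono : Monotone pt
  coef : ℕ → ℝ

/-- The function that a step function represents. -/
def StepFunction.toFun (φ : StepFunction) (u : ℝ) : ℝ :=
  ∑ k ∈ Finset.range φ.n,
    φ.coef k * (Ioc (φ.pt k : ℝ) (φ.pt (k + 1) : ℝ)).indicator (fun _ => (1 : ℝ)) u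

/-- The elementary integral `∑_{k < n} coef k · (Z_{pt (k+1)} - Z_{pt k})` of a step function. -/
def StepFunction.integral {Ω : Type*} (φ : StepFunction) (Z : ℝ≥0 → Ω → ℝ) (ω : Ω) : ℝ :=
  ∑ k ∈ Finset.range φ.n, φ.coef k * (Z (φ.pt (k + 1)) ω - Z (φ.pt k) ω)

/-- `X` is (a version of) the integral `∫_0^t f(u) dZ_u` of the deterministic function `f`: there
are step functions on `[0, t]` that converge to `f` almost everywhere on `[0, t]` and whose
elementary integrals converge to `X` in probability.

For a driftless Lévy process with a symmetric Lévy measure (in particular for Brownian motion)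
the limit is, up to null sets, independent of the approximating sequence: convergence in
probability of the elementary integrals over `[0, t]` of `φ n - φ m` to `0` is then equivalent to
`∫_0^t |Ψ(μ (φ n - φ m)(u))| du → 0` for all `μ`, and this passes to every Borel subset of
`[0, t]`. -/
def IsStochasticIntegral {Ω : Type*} [MeasurableSpace Ω] (Z : ℝ≥0 → Ω → ℝ) (P : Measure Ω)
    (t : ℝ≥0) (f : ℝ → ℝ) (X : Ω → ℝ) : Prop :=
  ∃ φ : ℕ → StepFunction,
    (∀ n k, (φ n).pt k ≤ t) ∧
    (∀ᵐ u ∂(volume.restrict (Icc (0 : ℝ) t)),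
      Tendsto (fun n => (φ n).toFun u) atTop (𝓝 (f u))) ∧
    TendstoInMeasure P (fun n => (φ n).integral Z) atTop X

/-- `Y = (Y_t)_{t ∈ [0, T]}` is the Volterra process `Y_t = ∫_0^t g(t, s) dZ_s`. -/
structure IsVolterraProcess {Ω : Type*} [MeasurableSpace Ω] (Z : ℝ≥0 → Ω → ℝ) (P : Measure Ω)
    (T : ℝ≥0) (g : ℝ → ℝ → ℝ) (Y : ℝ≥0 → Ω → ℝ) : Prop where
  aemeasurable : ∀ t ≤ T, AEMeasurable (Y t) P
  isStochasticIntegral : ∀ t ≤ T, IsStochasticIntegral Z P t (g t) (Y t)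

/-! ### The Molchan–Golosov kernel -/

/-- The Molchan–Golosov kernel with Hurst index `H` and multiplicative constant `c`,
`K_H(t, s) = c s^{1/2-H} (t^{H-1/2} (t-s)^{H-1/2} - (H-1/2) ∫_s^t u^{H-3/2} (u-s)^{H-1/2} du)`
for `0 < s < t`. -/
def molchanGolosovKernel (c H t s : ℝ) : ℝ :=
  c * s ^ (1 / 2 - H) *
    (t ^ (H - 1 / 2) * (t - s) ^ (H - 1 / 2) -
      (H - 1 / 2) * ∫ u in s..t, u ^ (H - 3 / 2) * (u - s) ^ (H - 1 / 2))

/-! ### Hölder continuity of trajectories -/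

/-- The process `(Y_t)_{t ∈ [0, T]}` has a modification all of whose trajectories are, on
`[0, T]`, Hölder continuous of every order `ϰ ∈ (0, r)`. (A process defined by stochastic
integrals is determined, for each `t`, only up to a null set.) -/
def HasHolderTrajectories {Ω : Type*} [MeasurableSpace Ω] (P : Measure Ω) (T : ℝ≥0)
    (Y : ℝ≥0 → Ω → ℝ) (r : ℝ) : Prop :=
  ∃ Y' : ℝ≥0 → Ω → ℝ,
    (∀ t ≤ T, Measurable (Y' t) ∧ Y' t =ᵐ[P] Y t) ∧
    ∀ ω : Ω, ∀ κ : ℝ≥0, 0 < κ → (κ : ℝ) < r →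
      ∃ C : ℝ≥0, HolderOnWith C κ (fun t => Y' t ω) (Icc 0 T)

end

/-! ### Step functions -/

namespace StepFunction

/-! Both cases rest on one feature of `Z`: its increments are independent and their characteristic
exponent is real, `exp (-(t - s) ψ(μ))` with `0 ≤ ψ(μ) ≤ σ μ²` (`HasIncrementExponent`). A step
function `φ` then integrates to a variable with characteristic function `exp (-∫ ψ(μ φ))`, and a
Fatou argument (`lintegral_sq_le_of_charFun`) turns the quadratic bound on `ψ` into `E (∫ φ dZ)² ≤
2σ ∫ φ²`. Square integrable kernels are therefore integrable by completeness of `L²`.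

The definition of the integral only asks for almost everywhere convergence of the step functions, so
uniqueness is a separate point: `ae_eq_zero_of_isStochasticIntegral` obtains it from Fatou's lemma
applied to `ψ(μ (h n - h m))`. It lets any version of the integral be computed along an
`L²`-convergent sequence. For Brownian motion the integral is Gaussian with variance the squared
`L²` norm of the integrand.

An increment of `Y` is the integral of `K(t, ·) - 1_{[0,s]} K(s, ·)`, so the moment bounds reduce to
the deterministic estimate that this function has squared norm at most `C (t - s)^{2θ}` for every `θ
< H` (`lintegral_molchanGolosovKernel_increment_sq_le`). With `α = H - 1/2`, it comes from `|K(t,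
u)| ≤ C (t/u)^γ (t - u)^α`, where `|α| < γ < 1/2`, and from an explicit formula for `K(t, u) - K(s,
u)` when `t ≤ 2s`. When `t > 2s` no cancellation is needed, since then `t < 2(t - s)`.

Hölder continuity follows by Kolmogorov–Chentsov chaining along dyadic points. Only second moments
are available in the Lévy case, which costs `1/2` in the exponent; arbitrarily high Gaussian moments
make the loss vanish. -/

lemma toFun_eq_integral (φ : StepFunction) (u : ℝ) :
    φ.toFun u = φ.integral (fun x (v : ℝ) => if v ≤ x then 1 else 0) u := by
  unfold toFun integral
  refine Finset.sum_congr rfl fun k _ => ?_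
  have h : (φ.pt k : ℝ) ≤ φ.pt (k + 1) := by exact_mod_cast φ.mono (Nat.le_succ k)
  simp only [indicator, mem_Ioc]
  split_ifs <;> grind

/-- Testing the right endpoint of each grid cell selects the cells inside `(s i, s j]`, and the sum
telescopes. Grid points may repeat, but degenerate cells contribute `0`; this is why `s i ≤ s j` is
assumed rather than `i ≤ j`. -/
lemma sum_indicator_mul_sub {s : ℕ → ℝ≥0} (hs : Monotone s) {i j N : ℕ} (hij : s i ≤ s j)
    (hj : j ≤ N) (F : ℝ≥0 → ℝ) :
    ∑ k ∈ Finset.range N, (Ioc (s i : ℝ) (s j : ℝ)).indicator (fun _ => (1 : ℝ)) (s (k + 1)) *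
      (F (s (k + 1)) - F (s k)) = F (s j) - F (s i) := by
  rcases le_or_gt j i with h | h
  · have h' : s j = s i := le_antisymm (hs h) hij
    simp [h']
  have key : ∀ k ∈ Finset.range N,
      (Ioc (s i : ℝ) (s j : ℝ)).indicator (fun _ => (1 : ℝ)) (s (k + 1)) *
      (F (s (k + 1)) - F (s k)) = if k ∈ Finset.Ico i j then F (s (k + 1)) - F (s k) else 0 := by
    intro k _
    have h1 : s k ≤ s (k + 1) := hs (Nat.le_succ k)
    simp only [indicator, mem_Ioc, NNReal.coe_lt_coe, NNReal.coe_le_coe, Finset.mem_Ico]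
    by_cases hk : i ≤ k ∧ k < j
    · have h2 : s i ≤ s k := hs hk.1
      have h3 : s (k + 1) ≤ s j := hs hk.2
      rcases h1.eq_or_lt with h4 | h4
      · simp [h4]
      · simp [hk, h2.trans_lt h4, h3]
    · rw [if_neg hk]
      by_cases hk1 : i ≤ k
      · have h2 : s j ≤ s k := hs (by grind)
        by_cases h3 : s (k + 1) ≤ s j
        · have : s (k + 1) = s k := le_antisymm (h3.trans h2) h1
          simp [this]
        · simp [h3]
      · have h2 : s (k + 1) ≤ s i := hs (by grind)
        simp [h2.not_gt]
  rw [Finset.sum_congr rfl key, Finset.sum_ite_mem, Finset.inter_eq_right.2 (by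
    intro k hk; simp at hk ⊢; omega), Finset.sum_Ico_eq_sub _ h.le,
    Finset.sum_range_sub (fun k => F (s k)), Finset.sum_range_sub (fun k => F (s k))]
  ring

/-- The elementary integral can be computed along any grid that contains the partition points. -/
lemma integral_eq_sum_grid {Ω : Type*} (φ : StepFunction) {s : ℕ → ℝ≥0} (hs : Monotone s) {N : ℕ}
    (h : ∀ k ≤ φ.n, ∃ i ≤ N, s i = φ.pt k) (F : ℝ≥0 → Ω → ℝ) (ω : Ω) :
    φ.integral F ω =
      ∑ k ∈ Finset.range N, φ.toFun (s (k + 1)) * (F (s (k + 1)) ω - F (s k) ω) := by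
  unfold integral toFun
  simp_rw [Finset.sum_mul]
  rw [Finset.sum_comm]
  refine Finset.sum_congr rfl fun k hk => ?_
  have hk := Finset.mem_range.1 hk
  obtain ⟨i, -, hi⟩ := h k hk.le
  obtain ⟨j, hj, hj'⟩ := h (k + 1) hk
  simp_rw [mul_assoc]
  rw [← Finset.mul_sum, ← hi, ← hj',
    sum_indicator_mul_sub hs (by rw [hi, hj']; exact φ.mono (Nat.le_succ k)) hj (fun x => F x ω)]

lemma exists_monotone_enumeration (S : Finset ℝ≥0) (hS : S.Nonempty) :
    ∃ (N : ℕ) (s : ℕ → ℝ≥0), Monotone s ∧ (∀ k, s k ∈ S) ∧ ∀ x ∈ S, ∃ i ≤ N, s i = x := by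
  have hc : 0 < S.card := hS.card_pos
  -- Capping the index at the last element makes the enumeration a monotone sequence defined on all
  -- of `ℕ`.
  refine ⟨S.card - 1, fun k => S.orderEmbOfFin rfl ⟨min k (S.card - 1), by omega⟩, ?_, ?_, ?_⟩
  · intro a b hab
    simp only [OrderEmbedding.le_iff_le, Fin.mk_le_mk]
    omega
  · intro k
    exact S.orderEmbOfFin_mem rfl _
  · intro x hx
    have : x ∈ Set.range (S.orderEmbOfFin rfl) := by rw [S.range_orderEmbOfFin]; exact hx
    obtain ⟨i, hi⟩ := this
    refine ⟨i, by omega, ?_⟩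
    rw [← hi]
    have hi2 := i.2
    have hmin : min (i : ℕ) (S.card - 1) = i := by omega
    simp only [hmin]

/-- The difference of two step functions is a step function. -/
lemma exists_sub (φ₁ φ₂ : StepFunction) {t : ℝ≥0} (h₁ : ∀ k, φ₁.pt k ≤ t) (h₂ : ∀ k, φ₂.pt k ≤ t) :
    ∃ φ : StepFunction, (∀ k, φ.pt k ≤ t) ∧ (∀ u, φ.toFun u = φ₁.toFun u - φ₂.toFun u) ∧
      ∀ {Ω : Type*} (Z : ℝ≥0 → Ω → ℝ) (ω : Ω),
        φ.integral Z ω = φ₁.integral Z ω - φ₂.integral Z ω := by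
  classical
  set S : Finset ℝ≥0 := (Finset.range (φ₁.n + 1)).image φ₁.pt ∪ (Finset.range (φ₂.n + 1)).image φ₂.pt
  have hS1 : ∀ k ≤ φ₁.n, φ₁.pt k ∈ S := fun k hk =>
    Finset.mem_union_left _ (Finset.mem_image_of_mem _ (Finset.mem_range.2 (by omega)))
  have hS2 : ∀ k ≤ φ₂.n, φ₂.pt k ∈ S := fun k hk =>
    Finset.mem_union_right _ (Finset.mem_image_of_mem _ (Finset.mem_range.2 (by omega)))
  obtain ⟨N, s, hs, hmem, hsurj⟩ := exists_monotone_enumeration S ⟨_, hS1 0 (Nat.zero_le _)⟩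
  have hSt : ∀ x ∈ S, x ≤ t := by
    intro x hx
    simp only [S, Finset.mem_union, Finset.mem_image] at hx
    rcases hx with ⟨k, -, rfl⟩ | ⟨k, -, rfl⟩
    · exact h₁ k
    · exact h₂ k
  -- Cells are closed on the right, so the value on a cell is the value at its right endpoint.
  let φ : StepFunction := ⟨N, s, hs, fun k => φ₁.toFun (s (k + 1)) - φ₂.toFun (s (k + 1))⟩
  have hint : ∀ {Ω : Type _} (Z : ℝ≥0 → Ω → ℝ) (ω : Ω),
        φ.integral Z ω = φ₁.integral Z ω - φ₂.integral Z ω := by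
    intro Ω Z ω
    rw [integral_eq_sum_grid φ₁ hs (fun k hk => hsurj _ (hS1 k hk)),
      integral_eq_sum_grid φ₂ hs (fun k hk => hsurj _ (hS2 k hk)), ← Finset.sum_sub_distrib]
    unfold integral
    refine Finset.sum_congr rfl fun k _ => ?_
    simp only [φ]
    ring
  have hfun : ∀ u, φ.toFun u = φ₁.toFun u - φ₂.toFun u := by
    intro u
    -- The value at `u` is itself an elementary integral, against the process `x ↦ 1_{v ≤ x}`
    -- evaluated at the outcome `v = u`. The grid formula thus gives the pointwise identity too.
    simp_rw [toFun_eq_integral]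
    rw [integral_eq_sum_grid φ₁ hs (fun k hk => hsurj _ (hS1 k hk)),
      integral_eq_sum_grid φ₂ hs (fun k hk => hsurj _ (hS2 k hk)), ← Finset.sum_sub_distrib]
    unfold integral
    refine Finset.sum_congr rfl fun k _ => ?_
    simp only [φ]
    ring
  exact ⟨φ, fun k => hSt _ (hmem k), hfun, hint⟩

lemma pairwise_disjoint_Ioc (φ : StepFunction) {i j : ℕ} {u : ℝ}
    (hi : u ∈ Ioc (φ.pt i : ℝ) (φ.pt (i + 1))) (hj : u ∈ Ioc (φ.pt j : ℝ) (φ.pt (j + 1))) :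
    i = j := by
  have hm : ∀ {a b : ℕ}, a ≤ b → (φ.pt a : ℝ) ≤ φ.pt b := fun h => by exact_mod_cast φ.mono h
  rcases lt_trichotomy i j with h | h | h
  · exact absurd (hi.2.trans (hm h)) hj.1.not_ge
  · exact h
  · exact absurd (hj.2.trans (hm h)) hi.1.not_ge

lemma toFun_eq_coef (φ : StepFunction) {k : ℕ} (hk : k < φ.n) {u : ℝ}
    (hu : u ∈ Ioc (φ.pt k : ℝ) (φ.pt (k + 1))) : φ.toFun u = φ.coef k := by
  unfold toFun
  rw [Finset.sum_eq_single k]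
  · simp only [indicator_of_mem hu, mul_one]
  · intro j _ hj
    rw [indicator_of_notMem (fun h => hj (φ.pairwise_disjoint_Ioc h hu)), mul_zero]
  · intro h
    exact absurd (Finset.mem_range.2 hk) h

lemma toFun_eq_zero (φ : StepFunction) {u : ℝ}
    (hu : ∀ k < φ.n, u ∉ Ioc (φ.pt k : ℝ) (φ.pt (k + 1))) : φ.toFun u = 0 := by
  unfold toFun
  refine Finset.sum_eq_zero fun k hk => ?_
  rw [indicator_of_notMem (hu k (Finset.mem_range.1 hk)), mul_zero]

lemma toFun_eq_zero_of_lt (φ : StepFunction) {t : ℝ≥0} (h : ∀ k, φ.pt k ≤ t) {u : ℝ}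
    (hu : (t : ℝ) < u) : φ.toFun u = 0 :=
  φ.toFun_eq_zero fun k _ hk => by
    have : (φ.pt (k + 1) : ℝ) ≤ t := by exact_mod_cast h (k + 1)
    linarith [hk.2]

/-- The cells are disjoint, so at most one term of the sum survives at `u` and `G` passes through
it; `G 0 = 0` covers the points outside all cells. -/
lemma comp_toFun (φ : StepFunction) {G : ℝ → ℝ} (hG : G 0 = 0) (u : ℝ) :
    G (φ.toFun u) = ∑ k ∈ Finset.range φ.n,
      G (φ.coef k) * (Ioc (φ.pt k : ℝ) (φ.pt (k + 1) : ℝ)).indicator (fun _ => (1 : ℝ)) u := by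
  let φ' : StepFunction := ⟨φ.n, φ.pt, φ.mono, fun k => G (φ.coef k)⟩
  change G (φ.toFun u) = φ'.toFun u
  by_cases h : ∃ k < φ.n, u ∈ Ioc (φ.pt k : ℝ) (φ.pt (k + 1))
  · obtain ⟨k, hk, hu⟩ := h
    rw [φ.toFun_eq_coef hk hu, φ'.toFun_eq_coef hk hu]
  · push Not at h
    rw [φ.toFun_eq_zero h, φ'.toFun_eq_zero h, hG]

lemma measurable_toFun (φ : StepFunction) : Measurable φ.toFun := by
  unfold toFun
  refine Finset.measurable_sum _ fun k _ => ?_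
  exact (measurable_const.indicator measurableSet_Ioc).const_mul _

lemma integrable_comp_toFun (φ : StepFunction) {G : ℝ → ℝ} (hG : G 0 = 0) :
    Integrable (fun u => G (φ.toFun u)) := by
  simp_rw [φ.comp_toFun hG]
  refine integrable_finsetSum _ fun k _ => Integrable.const_mul ?_ _
  exact (integrableOn_const (by simp)).integrable_indicator measurableSet_Ioc

lemma integral_comp_toFun (φ : StepFunction) {G : ℝ → ℝ} (hG : G 0 = 0) :
    ∫ u, G (φ.toFun u) =
      ∑ k ∈ Finset.range φ.n, G (φ.coef k) * ((φ.pt (k + 1) : ℝ) - φ.pt k) := by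
  simp_rw [φ.comp_toFun hG]
  rw [integral_finsetSum]
  · refine Finset.sum_congr rfl fun k _ => ?_
    have : (φ.pt k : ℝ) ≤ φ.pt (k + 1) := by exact_mod_cast φ.mono (Nat.le_succ k)
    rw [integral_const_mul, integral_indicator measurableSet_Ioc]
    simp [this]
  · refine fun k _ => Integrable.const_mul ?_ _
    exact (integrableOn_const (by simp)).integrable_indicator measurableSet_Ioc

end StepFunction

/-! ### Approximation by step functions -/

lemma exists_stepFunction_forall_dist_le {g : ℝ → ℝ} (hg : Continuous g) (t : ℝ≥0) {δ : ℝ}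
    (hδ : 0 < δ) : ∃ φ : StepFunction, (∀ k, φ.pt k ≤ t) ∧
      ∀ u ∈ Ioc (0 : ℝ) t, |φ.toFun u - g u| ≤ δ := by
  have huc := isCompact_Icc.uniformContinuousOn_of_continuous
    (hg.continuousOn (s := Icc (0 : ℝ) t))
  rw [Metric.uniformContinuousOn_iff] at huc
  obtain ⟨η, hη, huc⟩ := huc δ hδ
  obtain ⟨N, hN⟩ := exists_nat_gt ((t : ℝ) / η)
  have hN0 : (0 : ℝ) < N := (div_nonneg t.2 hη.le).trans_lt hN
  have hN1 : (t : ℝ) / N < η := by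
    rw [div_lt_iff₀ hη] at hN
    rw [div_lt_iff₀ hN0]; linarith
  -- The cap at `t` keeps the points with index beyond `N` inside `[0, t]`.
  let pt : ℕ → ℝ≥0 := fun k => min (k * (t / N)) t
  have hpt : ∀ k, (pt k : ℝ) = min (k * ((t : ℝ) / N)) t := fun k => by simp [pt]
  refine ⟨⟨N, pt, ?_, fun k => g (pt (k + 1))⟩, fun k => min_le_right _ _, ?_⟩
  · intro a b hab
    refine min_le_min_right _ ?_
    gcongr
  intro u hu
  have ht : (0 : ℝ) < t := hu.1.trans_le hu.2
  have hd : 0 < (t : ℝ) / N := div_pos ht hN0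
  -- A ceiling rather than a floor, because the cells are closed on the right.
  obtain ⟨k, hk⟩ : ∃ k, ⌈u / (t / N)⌉₊ = k + 1 :=
    Nat.exists_eq_succ_of_ne_zero (Nat.ceil_pos.2 (div_pos hu.1 hd)).ne'
  have h1 : u ≤ (k + 1 : ℕ) * ((t : ℝ) / N) := by
    rw [← div_le_iff₀ hd, ← hk]; exact Nat.le_ceil _
  have h2 : (k : ℝ) * ((t : ℝ) / N) < u := by
    rw [← lt_div_iff₀ hd, ← Nat.lt_ceil, hk]; exact Nat.lt_succ_self k
  have hkN : k < N := by
    have : (k : ℝ) * (t / N) < N * (t / N) := by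
      rw [mul_div_cancel₀ _ hN0.ne']; exact h2.trans_le hu.2
    exact_mod_cast lt_of_mul_lt_mul_right this hd.le
  have hmem : u ∈ Ioc (pt k : ℝ) (pt (k + 1)) := by
    rw [hpt, hpt]
    exact ⟨(min_le_left _ _).trans_lt h2, le_min h1 hu.2⟩
  rw [StepFunction.toFun_eq_coef _ hkN hmem]
  refine (huc (pt (k + 1) : ℝ) ⟨NNReal.coe_nonneg _, ?_⟩ u ⟨hu.1.le, hu.2⟩ ?_).le
  · exact_mod_cast min_le_right _ _
  · rw [Real.dist_eq, abs_of_nonneg (sub_nonneg.2 hmem.2)]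
    have : (pt (k + 1) : ℝ) ≤ (k + 1 : ℕ) * ((t : ℝ) / N) := by rw [hpt]; exact min_le_left _ _
    push_cast at this
    linarith

lemma ae_restrict_Icc_mem_Ioc (t : ℝ) : ∀ᵐ u ∂(volume.restrict (Icc (0 : ℝ) t)), u ∈ Ioc 0 t := by
  rw [← restrict_Ioc_eq_restrict_Icc]
  exact ae_restrict_mem measurableSet_Ioc

/-- Square integrable functions on `[0, t]` are limits, in `L²` and almost everywhere, of step
functions on `[0, t]`. -/
lemma exists_stepFunction_seq {t : ℝ≥0} {f : ℝ → ℝ}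
    (hf : MemLp f 2 (volume.restrict (Icc (0 : ℝ) t))) :
    ∃ φ : ℕ → StepFunction, (∀ n k, (φ n).pt k ≤ t) ∧
      (∀ᵐ u ∂(volume.restrict (Icc (0 : ℝ) t)),
        Tendsto (fun n => (φ n).toFun u) atTop (𝓝 (f u))) ∧
      Tendsto (fun n => eLpNorm ((φ n).toFun - f) 2 (volume.restrict (Icc (0 : ℝ) t)))
        atTop (𝓝 0) := by
  set m := volume.restrict (Icc (0 : ℝ) t) with hm
  have key : ∀ ε : ℝ≥0∞, ε ≠ 0 → ∃ φ : StepFunction, (∀ k, φ.pt k ≤ t) ∧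
      eLpNorm (φ.toFun - f) 2 m ≤ ε := by
    intro ε hε
    have hε2 : ε / 2 ≠ 0 := by simp [hε]
    obtain ⟨g, hg, -⟩ := hf.exists_boundedContinuous_eLpNorm_sub_le (by simp) hε2
    have hlim : Tendsto (fun δ : ℝ => (m univ) ^ ((2 : ℝ≥0∞).toReal⁻¹) * ENNReal.ofReal δ)
        (𝓝[>] 0) (𝓝 0) := by
      have h1 : Tendsto (fun δ : ℝ => ENNReal.ofReal δ) (𝓝[>] 0) (𝓝 0) := by
        have := (ENNReal.continuous_ofReal.tendsto (0 : ℝ))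
        rw [ENNReal.ofReal_zero] at this
        exact this.mono_left nhdsWithin_le_nhds
      have h2 := ENNReal.Tendsto.const_mul (a := (m univ) ^ ((2 : ℝ≥0∞).toReal⁻¹)) h1
        (Or.inr (ENNReal.rpow_ne_top_of_nonneg (by positivity) (by simp [hm])))
      simpa using h2
    obtain ⟨δ, hδ, hδ0⟩ := ((hlim.eventually (gt_mem_nhds (pos_iff_ne_zero.2 hε2))).and
      self_mem_nhdsWithin).exists
    obtain ⟨φ, hφt, hφ⟩ := exists_stepFunction_forall_dist_le g.continuous t hδ0
    refine ⟨φ, hφt, ?_⟩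
    have h1 : eLpNorm (φ.toFun - ⇑g) 2 m ≤ ε / 2 := by
      refine (eLpNorm_le_of_ae_bound (C := δ) ?_).trans hδ.le
      filter_upwards [ae_restrict_Icc_mem_Ioc t] with u hu
      exact hφ u hu
    have h2 : eLpNorm (⇑g - f) 2 m ≤ ε / 2 := by rwa [eLpNorm_sub_comm]
    have h3 : φ.toFun - f = (φ.toFun - ⇑g) + (⇑g - f) := by simp
    rw [h3]
    refine (eLpNorm_add_le ?_ ?_ (by norm_num)).trans ?_
    · exact φ.measurable_toFun.aestronglyMeasurable.sub g.continuous.aestronglyMeasurable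
    · exact g.continuous.aestronglyMeasurable.sub hf.1
    · exact (add_le_add h1 h2).trans (ENNReal.add_halves ε).le
  choose φ hφt hφ using fun n : ℕ => key ((n : ℝ≥0∞)⁻¹) (by simp)
  have hlim : Tendsto (fun n => eLpNorm ((φ n).toFun - f) 2 m) atTop (𝓝 0) :=
    tendsto_of_tendsto_of_tendsto_of_le_of_le tendsto_const_nhds ENNReal.tendsto_inv_nat_nhds_zero
      (fun _ => zero_le) hφ
  obtain ⟨ns, hns, hae⟩ := (tendstoInMeasure_of_tendsto_eLpNorm (by norm_num)
    (fun n => (φ n).measurable_toFun.aestronglyMeasurable) hf.1 hlim).exists_seq_tendsto_ae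
  exact ⟨fun n => φ (ns n), fun n => hφt _, hae, hlim.comp hns.tendsto_atTop⟩

/-! ### Characteristic functions -/

lemma re_charFun_eq_integral_cos {Ω : Type*} [MeasurableSpace Ω] {P : Measure Ω}
    [IsProbabilityMeasure P] {W : Ω → ℝ} (hW : AEMeasurable W P) (μ : ℝ) :
    (charFun (P.map W) μ).re = ∫ ω, Real.cos (μ * W ω) ∂P := by
  rw [charFun_apply_real, integral_map hW (by fun_prop)]
  have hint : Integrable (fun ω => Complex.exp (μ * W ω * Complex.I)) P := by
    refine Integrable.of_bound (C := 1) (by fun_prop) (ae_of_all _ fun ω => ?_)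
    rw [← Complex.ofReal_mul, Complex.norm_exp_ofReal_mul_I]
  have h := integral_re hint
  simp only [RCLike.re_to_complex] at h
  rw [← h]
  refine integral_congr_ae (ae_of_all _ fun ω => ?_)
  simp only
  rw [← Complex.ofReal_mul, Complex.exp_ofReal_mul_I_re]

/-- Bounded approximations of `x²` whose expectations are read off from the characteristic function;
by the half-angle formula they equal `x² sinc²(x / (2(n + 1)))`. -/
lemma tendsto_two_mul_one_sub_cos (x : ℝ) :
    Tendsto (fun n : ℕ => 2 * ((n : ℝ) + 1) ^ 2 * (1 - Real.cos (((n : ℝ) + 1)⁻¹ * x))) atTop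
      (𝓝 (x ^ 2)) := by
  have h1 : ∀ n : ℕ, 2 * ((n : ℝ) + 1) ^ 2 * (1 - Real.cos (((n : ℝ) + 1)⁻¹ * x)) =
      x ^ 2 * Real.sinc (((n : ℝ) + 1)⁻¹ * (x / 2)) ^ 2 := by
    intro n
    have hn : (n : ℝ) + 1 ≠ 0 := by positivity
    have h2 : ((n : ℝ) + 1)⁻¹ * x = 2 * (((n : ℝ) + 1)⁻¹ * (x / 2)) := by ring
    rw [h2, Real.cos_two_mul, Real.cos_sq']
    rcases eq_or_ne x 0 with rfl | hx
    · norm_num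
    · rw [Real.sinc_of_ne_zero (by positivity)]
      field_simp
      ring
  simp_rw [h1]
  have h3 : Tendsto (fun n : ℕ => ((n : ℝ) + 1)⁻¹ * (x / 2)) atTop (𝓝 0) := by
    have := (tendsto_one_div_add_atTop_nhds_zero_nat (𝕜 := ℝ)).mul_const (x / 2)
    simpa [one_div] using this
  have h4 := (Real.continuous_sinc.tendsto 0).comp h3
  rw [Real.sinc_zero] at h4
  simpa using (h4.pow 2).const_mul (x ^ 2)

/-- A quadratic bound for the characteristic function bounds the second moment. -/
lemma lintegral_sq_le_of_charFun {Ω : Type*} [MeasurableSpace Ω] {P : Measure Ω}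
    [IsProbabilityMeasure P] {W : Ω → ℝ} (hW : AEMeasurable W P) {A : ℝ}
    (h : ∀ μ, 1 - (charFun (P.map W) μ).re ≤ A * μ ^ 2) :
    ∫⁻ ω, ENNReal.ofReal (W ω ^ 2) ∂P ≤ ENNReal.ofReal (2 * A) := by
  set G : ℕ → Ω → ℝ :=
    fun n ω => 2 * ((n : ℝ) + 1) ^ 2 * (1 - Real.cos (((n : ℝ) + 1)⁻¹ * W ω)) with hG
  have hcos : ∀ μ : ℝ, Integrable (fun ω => Real.cos (μ * W ω)) P := fun μ =>
    Integrable.of_bound (C := 1) (by fun_prop) (ae_of_all _ fun ω => Real.abs_cos_le_one _)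
  have hGm : ∀ n, AEMeasurable (fun ω => ENNReal.ofReal (G n ω)) P := fun n => by
    simp only [hG]; fun_prop
  have hG0 : ∀ n ω, 0 ≤ G n ω := fun n ω =>
    mul_nonneg (by positivity) (sub_nonneg.2 (Real.cos_le_one _))
  -- Fatou's lemma along `G n → W²` presupposes no integrability of `W²`; the hypothesis at `μ = 1 /
  -- (n + 1)` bounds each `E (G n)` by `2A`.
  calc ∫⁻ ω, ENNReal.ofReal (W ω ^ 2) ∂P
      = ∫⁻ ω, liminf (fun n => ENNReal.ofReal (G n ω)) atTop ∂P := by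
        refine lintegral_congr fun ω => ?_
        exact (((ENNReal.continuous_ofReal.tendsto _).comp
          (tendsto_two_mul_one_sub_cos (W ω))).liminf_eq).symm
    _ ≤ liminf (fun n => ∫⁻ ω, ENNReal.ofReal (G n ω) ∂P) atTop := lintegral_liminf_le' hGm
    _ ≤ ENNReal.ofReal (2 * A) := by
        refine (liminf_le_liminf (v := fun _ => ENNReal.ofReal (2 * A))
          (Eventually.of_forall fun n => ?_)).trans (by simp)
        have hn : (0 : ℝ) < (n : ℝ) + 1 := by positivity
        have hGi : Integrable (G n) P := ((integrable_const _).sub (hcos _)).const_mul _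
        rw [← ofReal_integral_eq_lintegral_ofReal hGi (ae_of_all _ (hG0 n))]
        refine ENNReal.ofReal_le_ofReal ?_
        simp only [hG]
        rw [integral_const_mul, integral_sub (integrable_const _) (hcos _),
          ← re_charFun_eq_integral_cos hW]
        have h1 := h ((n : ℝ) + 1)⁻¹
        simp only [integral_const, probReal_univ, smul_eq_mul, mul_one]
        calc 2 * ((n : ℝ) + 1) ^ 2 * (1 - (charFun (P.map W) ((n : ℝ) + 1)⁻¹).re)
            ≤ 2 * ((n : ℝ) + 1) ^ 2 * (A * (((n : ℝ) + 1)⁻¹) ^ 2) := by gcongr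
          _ = 2 * A := by field_simp

lemma tendsto_charFun_of_tendstoInMeasure {Ω : Type*} [MeasurableSpace Ω] {P : Measure Ω}
    [IsProbabilityMeasure P] {X : ℕ → Ω → ℝ} {W : Ω → ℝ} (hX : ∀ n, AEMeasurable (X n) P)
    (h : TendstoInMeasure P X atTop W) (μ : ℝ) :
    Tendsto (fun n => charFun (P.map (X n)) μ) atTop (𝓝 (charFun (P.map W) μ)) :=
  ProbabilityMeasure.tendsto_iff_tendsto_charFun.1 (h.tendstoInDistribution hX).tendsto μ

/-- The second moment bound with `A = 0` already forces `E W² = 0`. -/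
lemma ae_eq_zero_of_charFun_eq_one {Ω : Type*} [MeasurableSpace Ω] {P : Measure Ω}
    [IsProbabilityMeasure P] {W : Ω → ℝ} (hW : AEMeasurable W P)
    (h : ∀ μ, charFun (P.map W) μ = 1) : W =ᵐ[P] 0 := by
  have h1 := lintegral_sq_le_of_charFun hW (A := 0) (fun μ => by simp [h μ])
  have h2 : ∫⁻ ω, ENNReal.ofReal (W ω ^ 2) ∂P = 0 := by simpa using h1
  rw [lintegral_eq_zero_iff' (by fun_prop)] at h2
  filter_upwards [h2] with ω hω
  have : W ω ^ 2 ≤ 0 := by simpa using hω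
  exact pow_eq_zero_iff (two_ne_zero) |>.1 (le_antisymm this (sq_nonneg _))

lemma tendstoInMeasure_sub {Ω ι : Type*} [MeasurableSpace Ω] {P : Measure Ω} {l : Filter ι}
    {X Y : ι → Ω → ℝ} {V W : Ω → ℝ}
    (hX : TendstoInMeasure P X l V) (hY : TendstoInMeasure P Y l W) :
    TendstoInMeasure P (fun n ω => X n ω - Y n ω) l (fun ω => V ω - W ω) := by
  rw [tendstoInMeasure_iff_norm] at *
  intro ε hε
  have h := (hX (ε / 2) (half_pos hε)).add (hY (ε / 2) (half_pos hε))
  rw [add_zero] at h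
  refine tendsto_of_tendsto_of_tendsto_of_le_of_le tendsto_const_nhds h (fun _ => zero_le)
    fun n => ?_
  refine (measure_mono fun ω hω => ?_).trans (measure_union_le _ _)
  simp only [Set.mem_ofPred_eq, Real.norm_eq_abs, Set.mem_union] at *
  by_contra! hc
  have : |X n ω - Y n ω - (V ω - W ω)| ≤ |X n ω - V ω| + |Y n ω - W ω| := by
    have := abs_sub (X n ω - V ω) (Y n ω - W ω)
    rwa [sub_sub_sub_comm] at this
  linarith [hc.1, hc.2]

/-! ### Processes with independent increments and real characteristic exponent -/

/-- `Z` has independent increments and `E exp (i μ (Z_t - Z_s)) = exp (-(t - s) ψ(μ))` where `ψ` is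
continuous and `0 ≤ ψ(μ) ≤ σ μ²`. -/
structure HasIncrementExponent {Ω : Type*} [MeasurableSpace Ω] (Z : ℝ≥0 → Ω → ℝ) (P : Measure Ω)
    (ψ : ℝ → ℝ) (σ : ℝ) : Prop where
  aemeasurable : ∀ t, AEMeasurable (Z t) P
  indepIncrements : HasIndepIncrements Z P
  charFun_eq : ∀ s t : ℝ≥0, s ≤ t → ∀ μ, charFun (P.map (fun ω => Z t ω - Z s ω)) μ =
    (Real.exp (-(((t : ℝ) - s) * ψ μ)) : ℂ)
  nonneg : ∀ μ, 0 ≤ ψ μ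
  le : ∀ μ, ψ μ ≤ σ * μ ^ 2
  continuous : Continuous ψ

namespace HasIncrementExponent

variable {Ω : Type*} [MeasurableSpace Ω] {Z : ℝ≥0 → Ω → ℝ} {P : Measure Ω} {ψ : ℝ → ℝ} {σ : ℝ}

lemma map_zero (hZ : HasIncrementExponent Z P ψ σ) : ψ 0 = 0 :=
  le_antisymm (by simpa using hZ.le 0) (hZ.nonneg 0)

lemma sigma_nonneg (hZ : HasIncrementExponent Z P ψ σ) : 0 ≤ σ := by
  simpa using (hZ.nonneg 1).trans (hZ.le 1)

lemma aemeasurable_integral (hZ : HasIncrementExponent Z P ψ σ) (φ : StepFunction) :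
    AEMeasurable (φ.integral Z) P := by
  unfold StepFunction.integral
  have := hZ.aemeasurable
  fun_prop

/-- Independence gives a product over the cells, and the exponents `ψ(μ c_k)` times the cell lengths
add up to the integral because `ψ 0 = 0`. -/
lemma charFun_integral (hZ : HasIncrementExponent Z P ψ σ) (φ : StepFunction) (μ : ℝ) :
    charFun (P.map (φ.integral Z)) μ = (Real.exp (-∫ u, ψ (μ * φ.toFun u)) : ℂ) := by
  have hm := hZ.aemeasurable
  have hind : iIndepFun (fun k ω => φ.coef k * (Z (φ.pt (k + 1)) ω - Z (φ.pt k) ω)) P :=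
    (hZ.indepIncrements.nat φ.mono).comp (fun k x => φ.coef k * x) (fun k => by fun_prop)
  have h1 := iIndepFun.charFun_map_fun_finsetSum_eq_prod (s := Finset.range φ.n)
    (fun k _ => by fun_prop) (hind.restrict (Finset.range φ.n))
  change charFun (P.map (fun ω => ∑ k ∈ Finset.range φ.n,
    φ.coef k * (Z (φ.pt (k + 1)) ω - Z (φ.pt k) ω))) μ = _
  rw [h1, Finset.prod_apply, φ.integral_comp_toFun (G := fun x => ψ (μ * x)) (by
    simp [hZ.map_zero]), ← Finset.sum_neg_distrib, Real.exp_sum, Complex.ofReal_prod]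
  refine Finset.prod_congr rfl fun k _ => ?_
  rw [charFun_map_mul_comp (by fun_prop), hZ.charFun_eq _ _ (φ.mono (Nat.le_succ k))]
  congr 3
  rw [mul_comm (φ.coef k), mul_comm]

lemma integrable_comp (hZ : HasIncrementExponent Z P ψ σ) (φ : StepFunction) (μ : ℝ) :
    Integrable (fun u => ψ (μ * φ.toFun u)) :=
  φ.integrable_comp_toFun (G := fun x => ψ (μ * x)) (by simp [hZ.map_zero])

lemma one_sub_re_charFun_le (hZ : HasIncrementExponent Z P ψ σ) (φ : StepFunction) (μ : ℝ) :
    1 - (charFun (P.map (φ.integral Z)) μ).re ≤ σ * (∫ u, φ.toFun u ^ 2) * μ ^ 2 := by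
  rw [hZ.charFun_integral, Complex.ofReal_re]
  have h1 := Real.one_sub_le_exp_neg (∫ u, ψ (μ * φ.toFun u))
  have h2 : ∫ u, ψ (μ * φ.toFun u) ≤ ∫ u, σ * μ ^ 2 * φ.toFun u ^ 2 :=
    integral_mono (hZ.integrable_comp φ μ)
      ((φ.integrable_comp_toFun (G := fun x => x ^ 2) (by simp)).const_mul _)
      (fun u => (hZ.le _).trans_eq (by ring))
  rw [integral_const_mul] at h2
  linarith

lemma lintegral_sq_integral_le [IsProbabilityMeasure P] (hZ : HasIncrementExponent Z P ψ σ)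
    (φ : StepFunction) :
    ∫⁻ ω, ENNReal.ofReal (φ.integral Z ω ^ 2) ∂P ≤ ENNReal.ofReal (2 * σ * ∫ u, φ.toFun u ^ 2) := by
  have := lintegral_sq_le_of_charFun (hZ.aemeasurable_integral φ) (hZ.one_sub_re_charFun_le φ)
  rwa [← mul_assoc] at this

end HasIncrementExponent

/-- Step functions with partition points in `[0, t]` vanish off `[0, t]`, so convergence extends to
the whole line with limit `f` extended by zero. -/
lemma ae_tendsto_toFun {t : ℝ≥0} {φ : ℕ → StepFunction} (hφ : ∀ n k, (φ n).pt k ≤ t) {f : ℝ → ℝ}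
    (h : ∀ᵐ u ∂(volume.restrict (Icc (0 : ℝ) t)),
      Tendsto (fun n => (φ n).toFun u) atTop (𝓝 (f u))) :
    ∀ᵐ u, Tendsto (fun n => (φ n).toFun u) atTop (𝓝 ((Icc (0 : ℝ) t).indicator f u)) := by
  rw [ae_restrict_iff' measurableSet_Icc] at h
  filter_upwards [h] with u hu
  by_cases hmem : u ∈ Icc (0 : ℝ) t
  · rw [indicator_of_mem hmem]; exact hu hmem
  · rw [indicator_of_notMem hmem]
    have : ∀ n, (φ n).toFun u = 0 := by
      intro n
      rcases le_or_gt 0 u with h0 | h0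
      · exact (φ n).toFun_eq_zero_of_lt (hφ n) (not_le.1 fun h1 => hmem ⟨h0, h1⟩)
      · refine (φ n).toFun_eq_zero fun k _ hk => ?_
        exact absurd hk.1 (not_lt.2 (h0.le.trans (NNReal.coe_nonneg _)))
    simp [this]

namespace HasIncrementExponent

variable {Ω : Type*} [MeasurableSpace Ω] {Z : ℝ≥0 → Ω → ℝ} {P : Measure Ω} {ψ : ℝ → ℝ} {σ : ℝ}

/-- Almost everywhere convergence comes with no dominating function, but `ψ ≥ 0` allows Fatou: `∫
ψ(μ h) ≤ liminf ∫ ψ(μ d_m) = -log r`. This one-sided bound suffices for uniqueness. -/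
lemma le_exp_neg_of_tendsto (hZ : HasIncrementExponent Z P ψ σ) (μ : ℝ) {h : StepFunction}
    {d : ℕ → StepFunction}
    (hd : ∀ᵐ u, Tendsto (fun m => (d m).toFun u) atTop (𝓝 (h.toFun u))) {r : ℝ}
    (hr : Tendsto (fun m => Real.exp (-∫ u, ψ (μ * (d m).toFun u))) atTop (𝓝 r)) :
    r ≤ Real.exp (-∫ u, ψ (μ * h.toFun u)) := by
  rcases le_or_gt r 0 with h0 | h0
  · exact h0.trans (Real.exp_pos _).le
  have h1 : Tendsto (fun m => ∫ u, ψ (μ * (d m).toFun u)) atTop (𝓝 (-Real.log r)) := by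
    have := ((Real.continuousAt_log h0.ne').tendsto.comp hr).neg
    simpa [Function.comp_def] using this
  have h2 : ∫⁻ u, ENNReal.ofReal (ψ (μ * h.toFun u)) ≤ ENNReal.ofReal (-Real.log r) := by
    calc ∫⁻ u, ENNReal.ofReal (ψ (μ * h.toFun u))
        = ∫⁻ u, liminf (fun m => ENNReal.ofReal (ψ (μ * (d m).toFun u))) atTop := by
          refine lintegral_congr_ae ?_
          filter_upwards [hd] with u hu
          refine (Tendsto.liminf_eq ?_).symm
          exact (ENNReal.continuous_ofReal.tendsto _).comp
            ((hZ.continuous.tendsto _).comp (hu.const_mul μ))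
      _ ≤ liminf (fun m => ∫⁻ u, ENNReal.ofReal (ψ (μ * (d m).toFun u))) atTop :=
          lintegral_liminf_le fun m => by
            have := hZ.continuous.measurable
            have := (d m).measurable_toFun
            fun_prop
      _ = ENNReal.ofReal (-Real.log r) := by
          refine Tendsto.liminf_eq ?_
          have := (ENNReal.continuous_ofReal.tendsto _).comp h1
          refine this.congr fun m => ?_
          exact ofReal_integral_eq_lintegral_ofReal (hZ.integrable_comp _ _)
            (ae_of_all _ fun u => hZ.nonneg _)
  rw [← ofReal_integral_eq_lintegral_ofReal (hZ.integrable_comp _ _)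
    (ae_of_all _ fun u => hZ.nonneg _)] at h2
  have h3 : 0 ≤ -Real.log r :=
    ge_of_tendsto' h1 fun m => integral_nonneg fun u => hZ.nonneg _
  have h4 := (ENNReal.ofReal_le_ofReal_iff h3).1 h2
  calc r = Real.exp (Real.log r) := (Real.exp_log h0).symm
    _ ≤ _ := Real.exp_le_exp.2 (by linarith)

/-- The stochastic integral of the zero function vanishes. -/
theorem ae_eq_zero_of_isStochasticIntegral [IsProbabilityMeasure P]
    (hZ : HasIncrementExponent Z P ψ σ) {t : ℝ≥0} {W : Ω → ℝ}
    (hW : IsStochasticIntegral Z P t (fun _ => 0) W) : W =ᵐ[P] 0 := by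
  obtain ⟨h, hpt, hae, hlim⟩ := hW
  have hWm : AEMeasurable W P := hlim.aemeasurable fun n => hZ.aemeasurable_integral _
  have hae' := ae_tendsto_toFun hpt hae
  simp only [indicator_zero] at hae'
  refine ae_eq_zero_of_charFun_eq_one hWm fun μ => ?_
  have hchar := tendsto_charFun_of_tendstoInMeasure (fun n => hZ.aemeasurable_integral (h n)) hlim μ
  -- For fixed `n`, `h n - h m → h n` almost everywhere while the integrals tend to `∫ h n dZ - W`,
  -- so `ρ n ≤ exp (-∫ ψ(μ h n)) ≤ 1`. Since `ρ n → 1`, the middle term tends to `1`; but it is also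
  -- the characteristic function of `∫ h n dZ`, whose limit is that of `W`.
  set ρ : ℕ → ℝ := fun n => (charFun (P.map (fun ω => (h n).integral Z ω - W ω)) μ).re
  have hle : ∀ n, ρ n ≤ Real.exp (-∫ u, ψ (μ * (h n).toFun u)) := by
    intro n
    choose d hd1 hd2 hd3 using fun m => StepFunction.exists_sub (h n) (h m) (hpt n) (hpt m)
    refine hZ.le_exp_neg_of_tendsto μ (d := d) ?_ ?_
    · filter_upwards [hae'] with u hu
      simp_rw [hd2]
      simpa using hu.const_sub ((h n).toFun u)
    · have h1 : TendstoInMeasure P (fun m => (d m).integral Z) atTop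
          (fun ω => (h n).integral Z ω - W ω) := by
        have hc : TendstoInMeasure P (fun _ : ℕ => (h n).integral Z) atTop ((h n).integral Z) := by
          intro ε hε
          simp [hε.not_ge]
        have := tendstoInMeasure_sub hc hlim
        refine this.congr_left fun m => ae_of_all _ fun ω => ?_
        exact (hd3 m Z ω).symm
      have h2 := tendsto_charFun_of_tendstoInMeasure
        (fun m => hZ.aemeasurable_integral (d m)) h1 μ
      have h3 := (Complex.continuous_re.tendsto _).comp h2
      refine h3.congr fun m => ?_
      simp only [Function.comp, hZ.charFun_integral, Complex.ofReal_re]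
  have hρ : Tendsto ρ atTop (𝓝 1) := by
    have hc : TendstoInMeasure P (fun _ : ℕ => W) atTop W := by
      intro ε hε
      simp [hε.not_ge]
    have h1 := tendstoInMeasure_sub hlim hc
    have h2 := tendsto_charFun_of_tendstoInMeasure
      (fun m => (hZ.aemeasurable_integral (h m)).sub hWm) h1 μ
    have h3 : Tendsto ρ atTop _ := (Complex.continuous_re.tendsto _).comp h2
    simpa using h3
  have h4 : Tendsto (fun n => Real.exp (-∫ u, ψ (μ * (h n).toFun u))) atTop (𝓝 1) :=
    tendsto_of_tendsto_of_tendsto_of_le_of_le hρ tendsto_const_nhds hle fun n =>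
      Real.exp_le_one_iff.2 (neg_nonpos.2 (integral_nonneg fun u => hZ.nonneg _))
  have h5 := (Complex.continuous_ofReal.tendsto _).comp h4
  refine tendsto_nhds_unique hchar ?_
  refine h5.congr fun n => ?_
  simp only [Function.comp, hZ.charFun_integral]

end HasIncrementExponent

/-! ### Square integrable functions -/

lemma eLpNorm_two_sq {α : Type*} [MeasurableSpace α] {m : Measure α} (f : α → ℝ) :
    eLpNorm f 2 m ^ 2 = ∫⁻ x, ENNReal.ofReal (f x ^ 2) ∂m := by
  have h := eLpNorm_nnreal_pow_eq_lintegral (f := f) (μ := m) (p := 2) (by norm_num)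
  simp only [NNReal.coe_ofNat, ENNReal.rpow_ofNat, ENNReal.coe_ofNat] at h
  rw [h]
  refine lintegral_congr fun x => ?_
  rw [← ofReal_norm, ← ENNReal.ofReal_pow (norm_nonneg _), Real.norm_eq_abs, sq_abs]

lemma MeasureTheory.MemLp.toReal_eLpNorm_two_sq {α : Type*} [MeasurableSpace α] {m : Measure α}
    {f : α → ℝ} (hf : MemLp f 2 m) : (eLpNorm f 2 m).toReal ^ 2 = ∫ x, f x ^ 2 ∂m := by
  rw [← ENNReal.toReal_pow, eLpNorm_two_sq,
    ← ofReal_integral_eq_lintegral_ofReal hf.integrable_sq (ae_of_all _ fun x => sq_nonneg _),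
    ENNReal.toReal_ofReal (integral_nonneg fun x => sq_nonneg _)]

lemma tendsto_integral_sq {α : Type*} [MeasurableSpace α] {m : Measure α} {g : ℕ → α → ℝ}
    {f : α → ℝ} (hg : ∀ n, MemLp (g n) 2 m) (hf : MemLp f 2 m)
    (h : Tendsto (fun n => eLpNorm (g n - f) 2 m) atTop (𝓝 0)) :
    Tendsto (fun n => ∫ x, g n x ^ 2 ∂m) atTop (𝓝 (∫ x, f x ^ 2 ∂m)) := by
  have h1 := ((Lp.tendsto_Lp_iff_tendsto_eLpNorm'' g hg f hf).2 h).norm.pow 2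
  simp only [Lp.norm_toLp, hf.toReal_eLpNorm_two_sq, (hg _).toReal_eLpNorm_two_sq] at h1
  exact h1

namespace StepFunction

lemma memLp_toFun (φ : StepFunction) (m : Measure ℝ) [IsFiniteMeasure m] : MemLp φ.toFun 2 m := by
  refine MemLp.of_bound (C := ∑ k ∈ Finset.range φ.n, |φ.coef k|)
    φ.measurable_toFun.aestronglyMeasurable (ae_of_all _ fun u => ?_)
  unfold toFun
  refine (norm_sum_le _ _).trans (Finset.sum_le_sum fun k _ => ?_)
  rw [norm_mul, Real.norm_eq_abs]
  refine mul_le_of_le_one_right (abs_nonneg _) ?_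
  simp only [indicator]
  split_ifs <;> simp

lemma integral_comp_toFun_eq_setIntegral (φ : StepFunction) {t : ℝ≥0} (h : ∀ k, φ.pt k ≤ t)
    {G : ℝ → ℝ} (hG : G 0 = 0) :
    ∫ u, G (φ.toFun u) = ∫ u in Icc (0 : ℝ) t, G (φ.toFun u) := by
  refine (setIntegral_eq_integral_of_forall_compl_eq_zero fun u hu => ?_).symm
  rcases le_or_gt 0 u with h0 | h0
  · rw [φ.toFun_eq_zero_of_lt h (not_le.1 fun h1 => hu ⟨h0, h1⟩), hG]
  · rw [φ.toFun_eq_zero fun k _ hk =>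
      absurd hk.1 (not_lt.2 (h0.le.trans (NNReal.coe_nonneg _))), hG]

end StepFunction

/-! ### Existence and basic properties of the stochastic integral -/

section

variable {Ω : Type*} [MeasurableSpace Ω] {Z : ℝ≥0 → Ω → ℝ} {P : Measure Ω}

lemma IsStochasticIntegral.sub {t : ℝ≥0} {f g : ℝ → ℝ} {X Y : Ω → ℝ}
    (hX : IsStochasticIntegral Z P t f X) (hY : IsStochasticIntegral Z P t g Y) :
    IsStochasticIntegral Z P t (fun u => f u - g u) (fun ω => X ω - Y ω) := by
  obtain ⟨φ, hφ, hφf, hφX⟩ := hX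
  obtain ⟨χ, hχ, hχg, hχY⟩ := hY
  choose d hd1 hd2 hd3 using fun n => StepFunction.exists_sub (φ n) (χ n) (hφ n) (hχ n)
  refine ⟨d, hd1, ?_, ?_⟩
  · filter_upwards [hφf, hχg] with u h1 h2
    simp_rw [hd2]
    exact h1.sub h2
  · exact (tendstoInMeasure_sub hφX hχY).congr_left fun m => ae_of_all _ fun ω => (hd3 m Z ω).symm

lemma IsStochasticIntegral.congr {t : ℝ≥0} {f g : ℝ → ℝ} {X : Ω → ℝ}
    (hX : IsStochasticIntegral Z P t f X)
    (h : f =ᵐ[volume.restrict (Icc (0 : ℝ) t)] g) : IsStochasticIntegral Z P t g X := by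
  obtain ⟨φ, hφ, hφf, hφX⟩ := hX
  refine ⟨φ, hφ, ?_, hφX⟩
  filter_upwards [hφf, h] with u h1 h2
  rwa [← h2]

lemma IsStochasticIntegral.extend {s t : ℝ≥0} (hst : s ≤ t) {f : ℝ → ℝ} {X : Ω → ℝ}
    (hX : IsStochasticIntegral Z P s f X) :
    IsStochasticIntegral Z P t ((Icc (0 : ℝ) s).indicator f) X := by
  obtain ⟨φ, hφ, hφf, hφX⟩ := hX
  exact ⟨φ, fun n k => (hφ n k).trans hst, ae_restrict_of_ae (ae_tendsto_toFun hφ hφf), hφX⟩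

end

namespace HasIncrementExponent

variable {Ω : Type*} [MeasurableSpace Ω] {Z : ℝ≥0 → Ω → ℝ} {P : Measure Ω} {ψ : ℝ → ℝ} {σ : ℝ}

lemma eLpNorm_integral_sq_le [IsProbabilityMeasure P] (hZ : HasIncrementExponent Z P ψ σ)
    (φ : StepFunction) {t : ℝ≥0} (h : ∀ k, φ.pt k ≤ t) :
    eLpNorm (φ.integral Z) 2 P ^ 2 ≤ ENNReal.ofReal (2 * σ) *
      eLpNorm φ.toFun 2 (volume.restrict (Icc (0 : ℝ) t)) ^ 2 := by
  rw [eLpNorm_two_sq, eLpNorm_two_sq]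
  refine (hZ.lintegral_sq_integral_le φ).trans_eq ?_
  rw [ENNReal.ofReal_mul (by linarith [hZ.sigma_nonneg]),
    φ.integral_comp_toFun_eq_setIntegral h (G := fun x => x ^ 2) (by simp),
    ofReal_integral_eq_lintegral_ofReal (φ.memLp_toFun _).integrable_sq
      (ae_of_all _ fun x => sq_nonneg _)]

/-- The integral of a square integrable function, as a limit of elementary integrals of step
functions that converge in `L²` and almost everywhere. -/
theorem exists_tendstoInMeasure_integral [IsProbabilityMeasure P]
    (hZ : HasIncrementExponent Z P ψ σ) {t : ℝ≥0} {f : ℝ → ℝ}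
    (hf : MemLp f 2 (volume.restrict (Icc (0 : ℝ) t))) :
    ∃ (X : Ω → ℝ) (φ : ℕ → StepFunction), AEMeasurable X P ∧ (∀ n k, (φ n).pt k ≤ t) ∧
      (∀ᵐ u ∂(volume.restrict (Icc (0 : ℝ) t)),
        Tendsto (fun n => (φ n).toFun u) atTop (𝓝 (f u))) ∧
      Tendsto (fun n => eLpNorm ((φ n).toFun - f) 2 (volume.restrict (Icc (0 : ℝ) t)))
        atTop (𝓝 0) ∧
      TendstoInMeasure P (fun n => (φ n).integral Z) atTop X := by
  obtain ⟨φ, hpt, hae, hlim⟩ := exists_stepFunction_seq hf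
  set m := volume.restrict (Icc (0 : ℝ) t) with hm
  set a : ℕ → ℝ≥0∞ := fun n => eLpNorm ((φ n).toFun - f) 2 m with ha
  -- The difference of two step functions is again one, so the second moment bound makes the
  -- elementary integrals Cauchy in `L²(P)`.
  have hdiff : ∀ i j, eLpNorm ((φ i).integral Z - (φ j).integral Z) 2 P ^ 2 ≤
      ENNReal.ofReal (2 * σ) * (a i + a j) ^ 2 := by
    intro i j
    obtain ⟨d, hd1, hd2, hd3⟩ := StepFunction.exists_sub (φ i) (φ j) (hpt i) (hpt j)
    have h1 : (φ i).integral Z - (φ j).integral Z = d.integral Z := by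
      funext ω; exact (hd3 Z ω).symm
    have h2 : d.toFun = ((φ i).toFun - f) - ((φ j).toFun - f) := by
      funext u; simp [hd2]
    rw [h1]
    refine (hZ.eLpNorm_integral_sq_le d hd1).trans ?_
    gcongr
    rw [h2]
    exact eLpNorm_sub_le (((φ i).memLp_toFun m).1.sub hf.1) (((φ j).memLp_toFun m).1.sub hf.1)
      (by norm_num)
  -- The completeness statement used below needs summable Cauchy bounds; a subsequence with rate
  -- `2⁻ᴺ` provides them.
  have hev : ∀ N : ℕ, ∀ᶠ k in atTop, ∀ i ≥ k, ∀ j ≥ k,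
      ENNReal.ofReal (2 * σ) * (a i + a j) ^ 2 < ((2⁻¹ : ℝ≥0∞) ^ N) ^ 2 := by
    intro N
    have h1 : Tendsto (fun p : ℕ × ℕ => ENNReal.ofReal (2 * σ) * (a p.1 + a p.2) ^ 2)
        (atTop ×ˢ atTop) (𝓝 (ENNReal.ofReal (2 * σ) * (0 + 0) ^ 2)) := by
      refine ENNReal.Tendsto.const_mul ?_ (Or.inr ENNReal.ofReal_ne_top)
      exact ENNReal.Tendsto.pow ((hlim.comp tendsto_fst).add (hlim.comp tendsto_snd))
    have hpos : ENNReal.ofReal (2 * σ) * (0 + 0) ^ 2 < ((2⁻¹ : ℝ≥0∞) ^ N) ^ 2 := by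
      rw [add_zero, zero_pow two_ne_zero, mul_zero]
      exact pos_iff_ne_zero.2 (by simp)
    have h2 := h1.eventually (gt_mem_nhds hpos)
    rw [prod_atTop_atTop_eq, eventually_atTop] at h2
    obtain ⟨p, hp⟩ := h2
    filter_upwards [eventually_ge_atTop (max p.1 p.2)] with k hk i hi j hj
    exact hp (i, j) ⟨(le_max_left _ _).trans (hk.trans hi), (le_max_right _ _).trans (hk.trans hj)⟩
  obtain ⟨ns, hns, hns'⟩ := extraction_forall_of_eventually hev
  have hmem : ∀ n, MemLp ((φ n).integral Z) 2 P := by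
    intro n
    refine ⟨(hZ.aemeasurable_integral _).aestronglyMeasurable, ?_⟩
    have h1 := hZ.eLpNorm_integral_sq_le (φ n) (hpt n)
    have h2 : eLpNorm (φ n).toFun 2 m < ∞ := ((φ n).memLp_toFun m).2
    by_contra! h3
    rw [top_le_iff.1 h3] at h1
    have h4 : ENNReal.ofReal (2 * σ) * eLpNorm (φ n).toFun 2 m ^ 2 < ∞ :=
      ENNReal.mul_lt_top ENNReal.ofReal_lt_top (ENNReal.pow_lt_top h2)
    simp only [ENNReal.top_pow, ne_eq, OfNat.ofNat_ne_zero, not_false_eq_true] at h1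
    exact absurd h1 (not_le.2 h4)
  obtain ⟨X, hX, hXlim⟩ := Lp.cauchy_complete_eLpNorm (p := 2) (by norm_num)
    (f := fun n => (φ (ns n)).integral Z) (μ := P) (fun n => hmem _)
    (B := fun n => (2⁻¹ : ℝ≥0∞) ^ n) (by rw [ENNReal.tsum_geometric_two]; norm_num) (by
      intro N i j hi hj
      have h1 := (hdiff (ns i) (ns j)).trans_lt
        (hns' N _ (hns.monotone hi) _ (hns.monotone hj))
      by_contra! h2
      exact h1.not_ge (pow_le_pow_left' h2 2))
  refine ⟨X, fun n => φ (ns n), hX.1.aemeasurable, fun n => hpt _, ?_,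
    hlim.comp hns.tendsto_atTop, ?_⟩
  · filter_upwards [hae] with u hu using hu.comp hns.tendsto_atTop
  · exact tendstoInMeasure_of_tendsto_eLpNorm (by norm_num) (fun n => (hmem _).1) hX.1 hXlim

theorem exists_isStochasticIntegral [IsProbabilityMeasure P]
    (hZ : HasIncrementExponent Z P ψ σ) {t : ℝ≥0} {f : ℝ → ℝ}
    (hf : MemLp f 2 (volume.restrict (Icc (0 : ℝ) t))) :
    ∃ X : Ω → ℝ, AEMeasurable X P ∧ IsStochasticIntegral Z P t f X := by
  obtain ⟨X, φ, h1, h2, h3, -, h4⟩ := hZ.exists_tendstoInMeasure_integral hf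
  exact ⟨X, h1, φ, h2, h3, h4⟩

/-- The integral of a square integrable function is a limit of elementary integrals of step
functions that converge in `L²`. -/
theorem exists_tendsto_eLpNorm [IsProbabilityMeasure P]
    (hZ : HasIncrementExponent Z P ψ σ) {t : ℝ≥0} {f : ℝ → ℝ}
    (hf : MemLp f 2 (volume.restrict (Icc (0 : ℝ) t))) {X : Ω → ℝ}
    (hX : IsStochasticIntegral Z P t f X) :
    ∃ φ : ℕ → StepFunction, (∀ n k, (φ n).pt k ≤ t) ∧
      Tendsto (fun n => ∫ u, (φ n).toFun u ^ 2) atTop (𝓝 (∫ u in Icc (0 : ℝ) t, f u ^ 2)) ∧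
      TendstoInMeasure P (fun n => (φ n).integral Z) atTop X := by
  obtain ⟨X', φ, -, h2, h3, h4, h5⟩ := hZ.exists_tendstoInMeasure_integral hf
  -- The sequence defining `X` need not converge in `L²`. The difference from the `L²` construction
  -- `X'` is an integral of `0`, hence null, so `X` inherits the good sequence.
  have h6 := hX.sub ⟨φ, h2, h3, h5⟩
  have h7 := hZ.ae_eq_zero_of_isStochasticIntegral (h6.congr (g := fun _ => 0)
    (ae_of_all _ fun u => sub_self _))
  refine ⟨φ, h2, ?_, h5.congr_right ?_⟩
  · have := tendsto_integral_sq (fun n => (φ n).memLp_toFun _) hf h4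
    refine this.congr fun n => ?_
    rw [(φ n).integral_comp_toFun_eq_setIntegral (h2 n) (G := fun x => x ^ 2) (by simp)]
  · filter_upwards [h7] with ω hω
    exact (sub_eq_zero.1 hω).symm

theorem lintegral_sq_le [IsProbabilityMeasure P]
    (hZ : HasIncrementExponent Z P ψ σ) {t : ℝ≥0} {f : ℝ → ℝ}
    (hf : MemLp f 2 (volume.restrict (Icc (0 : ℝ) t))) {X : Ω → ℝ}
    (hX : IsStochasticIntegral Z P t f X) :
    ∫⁻ ω, ENNReal.ofReal (X ω ^ 2) ∂P ≤
      ENNReal.ofReal (2 * (σ * ∫ u in Icc (0 : ℝ) t, f u ^ 2)) := by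
  obtain ⟨φ, -, h1, h2⟩ := hZ.exists_tendsto_eLpNorm hf hX
  have hm := fun n => hZ.aemeasurable_integral (φ n)
  refine lintegral_sq_le_of_charFun (h2.aemeasurable hm) fun μ => ?_
  have h3 := (Complex.continuous_re.tendsto _).comp (tendsto_charFun_of_tendstoInMeasure hm h2 μ)
  exact le_of_tendsto_of_tendsto' (h3.const_sub 1) ((h1.const_mul σ).mul_const (μ ^ 2))
    fun n => hZ.one_sub_re_charFun_le (φ n) μ

theorem map_eq_gaussianReal [IsProbabilityMeasure P]
    (hZ : HasIncrementExponent Z P (fun μ => μ ^ 2 / 2) σ) {t : ℝ≥0} {f : ℝ → ℝ}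
    (hf : MemLp f 2 (volume.restrict (Icc (0 : ℝ) t))) {X : Ω → ℝ}
    (hX : IsStochasticIntegral Z P t f X) :
    P.map X = gaussianReal 0 (∫ u in Icc (0 : ℝ) t, f u ^ 2).toNNReal := by
  obtain ⟨φ, -, h1, h2⟩ := hZ.exists_tendsto_eLpNorm hf hX
  have hm := fun n => hZ.aemeasurable_integral (φ n)
  have hXm := h2.aemeasurable hm
  have := Measure.isProbabilityMeasure_map (μ := P) hXm
  refine Measure.ext_of_charFun (funext fun μ => ?_)
  refine tendsto_nhds_unique (tendsto_charFun_of_tendstoInMeasure hm h2 μ) ?_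
  rw [charFun_gaussianReal, Real.coe_toNNReal _ (integral_nonneg fun u => sq_nonneg _)]
  have h3 : Tendsto (fun n => (Real.exp (-(μ ^ 2 / 2 * ∫ u, (φ n).toFun u ^ 2)) : ℂ)) atTop
      (𝓝 (Real.exp (-(μ ^ 2 / 2 * ∫ u in Icc (0 : ℝ) t, f u ^ 2)) : ℂ)) :=
    (Complex.continuous_ofReal.tendsto _).comp
      ((Real.continuous_exp.tendsto _).comp (h1.const_mul _).neg)
  convert h3 using 2
  · rw [hZ.charFun_integral, ← integral_const_mul]
    congr 3
    refine integral_congr_ae (ae_of_all _ fun u => ?_)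
    simp only
    ring
  · push_cast
    congr 1
    ring

end HasIncrementExponent

/-! ### Brownian motion and symmetric Lévy processes -/

theorem ProbabilityTheory.IsPreBrownianReal.hasIncrementExponent {Ω : Type*} [MeasurableSpace Ω]
    {Z : ℝ≥0 → Ω → ℝ} {P : Measure Ω} (hZ : IsPreBrownianReal Z P) :
    HasIncrementExponent Z P (fun μ => μ ^ 2 / 2) (1 / 2) where
  aemeasurable := hZ.aemeasurable
  indepIncrements := hZ.hasIndepIncrements
  charFun_eq s t hst μ := by
    have h := (hZ.hasLaw_sub t s).map_eq
    change P.map (fun ω => Z t ω - Z s ω) = _ at h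
    have hst' : (s : ℝ) ≤ t := hst
    have h1 : ((nndist t.1 s.1 : ℝ≥0) : ℝ) = (t : ℝ) - s := by
      rw [coe_nndist]
      exact (Real.dist_eq _ _).trans (abs_of_nonneg (sub_nonneg.2 hst'))
    rw [h, charFun_gaussianReal, h1]
    push_cast
    congr 1
    ring
  nonneg μ := by positivity
  le μ := by linarith
  continuous := by fun_prop

lemma levyTruncation_neg (z : ℝ) : levyTruncation (-z) = -levyTruncation z := by
  unfold levyTruncation
  rw [abs_neg]
  split_ifs <;> ring

/-- As the truncation is odd, `x ↦ -x` conjugates the integrand; invariance of `π` makes the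
integral its own conjugate. -/
lemma levyExponent_im {a : ℝ} {π : Measure ℝ} (hπ : π.map (fun x => -x) = π) (μ : ℝ) :
    (levyExponent a 0 π μ).im = 0 := by
  unfold levyExponent
  set F : ℝ → ℂ :=
    fun x => Complex.exp (Complex.I * μ * x) - 1 - Complex.I * μ * levyTruncation x with hF
  have h1 : (starRingEnd ℂ) (∫ x, F x ∂π) = ∫ x, F x ∂π := by
    rw [← integral_conj]
    calc ∫ x, (starRingEnd ℂ) (F x) ∂π = ∫ x, F (-x) ∂π := by
          refine integral_congr_ae (ae_of_all _ fun x => ?_)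
          simp only [hF, levyTruncation_neg, map_sub, map_mul, ← Complex.exp_conj, Complex.conj_I,
            Complex.conj_ofReal, map_one]
          push_cast
          ring_nf
      _ = ∫ x, F x ∂(π.map (MeasurableEquiv.neg ℝ)) :=
          (integral_map_equiv (MeasurableEquiv.neg ℝ) F).symm
      _ = ∫ x, F x ∂π := by
          congr 1
  have h2 := Complex.conj_eq_iff_im.1 h1
  have h3 : Complex.I * ((0 : ℝ) : ℂ) * μ - a * μ ^ 2 / 2 = ((-(a * μ ^ 2 / 2) : ℝ) : ℂ) := by
    push_cast
    ring
  rw [h3, Complex.add_im, Complex.ofReal_im, h2, add_zero]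

/-- The real part of the integrand is `cos (μ x) - 1`, which lies between `-μ² x² / 2` and `0`. -/
lemma levyExponent_re_mem {a : ℝ} (ha : 0 ≤ a) {π : Measure ℝ}
    (hfin : ∫⁻ x, ENNReal.ofReal (x ^ 2) ∂π < ∞) (μ : ℝ) :
    0 ≤ -(levyExponent a 0 π μ).re ∧
      -(levyExponent a 0 π μ).re ≤ (a / 2 + (∫ x, x ^ 2 ∂π) / 2) * μ ^ 2 := by
  unfold levyExponent
  set F : ℝ → ℂ :=
    fun x => Complex.exp (Complex.I * μ * x) - 1 - Complex.I * μ * levyTruncation x with hF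
  have hsq : Integrable (fun x : ℝ => x ^ 2) π :=
    (lintegral_ofReal_ne_top_iff_integrable (by fun_prop)
      (ae_of_all _ fun x => sq_nonneg x)).1 hfin.ne
  have hsq0 : 0 ≤ ∫ x, x ^ 2 ∂π := integral_nonneg fun x => sq_nonneg x
  have hre : ∀ x, (F x).re = Real.cos (μ * x) - 1 := by
    intro x
    have h1 : Complex.I * μ * x = ((μ * x : ℝ) : ℂ) * Complex.I := by push_cast; ring
    have h2 : Complex.I * μ * levyTruncation x = ((μ * levyTruncation x : ℝ) : ℂ) * Complex.I := by
      push_cast; ring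
    simp only [hF, Complex.sub_re, Complex.one_re]
    rw [h1, h2, Complex.exp_ofReal_mul_I_re, Complex.re_ofReal_mul, Complex.I_re]
    ring
  have hbound : 0 ≤ -(∫ x, F x ∂π).re ∧ -(∫ x, F x ∂π).re ≤ (∫ x, x ^ 2 ∂π) / 2 * μ ^ 2 := by
    by_cases hint : Integrable F π
    · have h1 := integral_re hint
      simp only [RCLike.re_to_complex, hre] at h1
      rw [← h1, ← integral_neg]
      refine ⟨integral_nonneg fun x => ?_, ?_⟩
      · simp only [Pi.zero_apply]
        linarith [Real.cos_le_one (μ * x)]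
      · have h2 : (∫ x, x ^ 2 ∂π) / 2 * μ ^ 2 = ∫ x, μ ^ 2 / 2 * x ^ 2 ∂π := by
          rw [integral_const_mul]; ring
        rw [h2]
        refine integral_mono_of_nonneg (ae_of_all _ fun x => ?_) (hsq.const_mul _)
          (ae_of_all _ fun x => ?_)
        · simp only [Pi.zero_apply]
          linarith [Real.cos_le_one (μ * x)]
        · have := Real.one_sub_sq_div_two_le_cos (x := μ * x)
          simp only
          nlinarith
    -- The default value `0` of the integral satisfies both bounds, so integrability of `F` need not
    -- be established.
    · rw [integral_undef hint]
      simp only [Complex.zero_re, neg_zero, le_refl, true_and]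
      positivity
  have h3 : Complex.I * ((0 : ℝ) : ℂ) * μ - a * μ ^ 2 / 2 = ((-(a * μ ^ 2 / 2) : ℝ) : ℂ) := by
    push_cast
    ring
  rw [h3, Complex.add_re, Complex.ofReal_re]
  have h4 : 0 ≤ a * μ ^ 2 / 2 := by positivity
  constructor
  · linarith [hbound.1]
  · linarith [hbound.2]

theorem IsLevyProcess.hasIncrementExponent {Ω : Type*} [MeasurableSpace Ω] {Z : ℝ≥0 → Ω → ℝ}
    {P : Measure Ω} [IsProbabilityMeasure P] (hZ : IsLevyProcess Z P) {a : ℝ} {π : Measure ℝ}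
    (hc : HasCharacteristicTriplet Z P a 0 π) (hπ : π.map (fun x => -x) = π)
    (hfin : ∫⁻ x, ENNReal.ofReal (x ^ 2) ∂π < ∞) :
    HasIncrementExponent Z P (fun μ => -(levyExponent a 0 π μ).re)
      (a / 2 + (∫ x, x ^ 2 ∂π) / 2) := by
  have hchar : ∀ (t : ℝ≥0) (μ : ℝ), charFun (P.map (Z t)) μ =
      (Real.exp (-((t : ℝ) * -(levyExponent a 0 π μ).re)) : ℂ) := by
    intro t μ
    have h1 : levyExponent a 0 π μ = ((levyExponent a 0 π μ).re : ℂ) :=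
      Complex.ext (by simp) (by simp [levyExponent_im hπ])
    rw [hc.charFun_eq, h1]
    push_cast
    simp
  refine ⟨hZ.aemeasurable, hZ.indepIncrements, ?_, fun μ => (levyExponent_re_mem hc.nonneg hfin μ).1,
    fun μ => (levyExponent_re_mem hc.nonneg hfin μ).2, ?_⟩
  · intro s t hst μ
    have h1 := (hZ.stationaryIncrements s (t - s)).map_eq
    rw [add_tsub_cancel_of_le hst] at h1
    rw [h1, hchar, NNReal.coe_sub hst]
  -- The exponent is minus the logarithm of the positive continuous characteristic function of `Z
  -- 1`, so it is continuous without any dominated convergence.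
  · have h1 : (fun μ => -(levyExponent a 0 π μ).re) =
        fun μ => -Real.log (charFun (P.map (Z 1)) μ).re := by
      funext μ
      rw [hchar, Complex.ofReal_re, Real.log_exp]
      simp
    rw [h1]
    have := Measure.isProbabilityMeasure_map (μ := P) (hZ.aemeasurable 1)
    refine (Continuous.log (Complex.continuous_re.comp continuous_charFun) fun μ => ?_).neg
    simp only [Function.comp]
    rw [hchar, Complex.ofReal_re]
    exact (Real.exp_pos _).ne'

/-! ### Estimates for the Molchan–Golosov kernel -/

lemma molchanGolosovKernel_eq (c α t u : ℝ) :
    molchanGolosovKernel c (α + 1 / 2) t u = c * (u ^ (-α) *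
      (t ^ α * (t - u) ^ α - α * ∫ v in u..t, v ^ (α - 1) * (v - u) ^ α)) := by
  unfold molchanGolosovKernel
  rw [mul_assoc, show 1 / 2 - (α + 1 / 2) = -α by ring, show α + 1 / 2 - 1 / 2 = α by ring,
    show α + 1 / 2 - 3 / 2 = α - 1 by ring]

lemma intervalIntegrable_sub_rpow {r : ℝ} (hr : -1 < r) (u a b : ℝ) :
    IntervalIntegrable (fun v => (v - u) ^ r) volume a b := by
  have := (intervalIntegral.intervalIntegrable_rpow' (a := a - u) (b := b - u) hr).comp_sub_right u
  simpa using this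

lemma integral_sub_rpow {r : ℝ} (hr : -1 < r) (u t : ℝ) :
    ∫ v in u..t, (v - u) ^ r = (t - u) ^ (r + 1) / (r + 1) := by
  rw [intervalIntegral.integral_comp_sub_right (fun x => x ^ r) u, sub_self,
    integral_rpow (Or.inl hr), Real.zero_rpow (by linarith), sub_zero]

lemma intervalIntegrable_rpow_mul_sub_rpow {α : ℝ} (hα : -1 < α) {u a b : ℝ} (ha : 0 < a)
    (hb : 0 < b) (β : ℝ) :
    IntervalIntegrable (fun v => v ^ β * (v - u) ^ α) volume a b := by
  refine (intervalIntegrable_sub_rpow hα u a b).continuousOn_mul ?_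
  refine ContinuousOn.rpow_const continuousOn_id fun x hx => Or.inl ?_
  rw [uIcc, mem_Icc] at hx
  exact ((lt_min ha hb).trans_le hx.1).ne'

/-- The auxiliary `γ` treats both signs of `α` at once. From `v^(α-1) ≤ u^(α-γ) (v-u)^(γ-1)` the
inner integrand is at most a multiple of `(v-u)^(α+γ-1)`, integrable at `u` because `α + γ > 0`.
Later `γ < 1/2` makes `(t/u)^γ` square integrable at `0`. -/
lemma abs_molchanGolosovKernel_le {c α γ t u : ℝ} (hc : 0 < c) (hα : -1 < α) (hγ : |α| < γ)
    (hγ1 : γ ≤ 1) (hu : 0 < u) (hut : u < t) :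
    |molchanGolosovKernel c (α + 1 / 2) t u| ≤
      c * (1 + |α| / (α + γ)) * ((t / u) ^ γ * (t - u) ^ α) := by
  have ht : 0 < t := hu.trans hut
  have htu : 0 < t - u := sub_pos.2 hut
  have hαγ : 0 < α + γ := by linarith [neg_abs_le α]
  have hγα : α < γ := (le_abs_self α).trans_lt hγ
  have hγ0 : 0 ≤ γ := (abs_nonneg α).trans hγ.le
  have hI0 : 0 ≤ ∫ v in u..t, v ^ (α - 1) * (v - u) ^ α := by
    refine intervalIntegral.integral_nonneg hut.le fun v hv => ?_
    have := hu.trans_le hv.1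
    have := sub_nonneg.2 hv.1
    positivity
  have hI : ∫ v in u..t, v ^ (α - 1) * (v - u) ^ α ≤
      u ^ (α - γ) * ((t - u) ^ (α + γ) / (α + γ)) := by
    calc ∫ v in u..t, v ^ (α - 1) * (v - u) ^ α
        ≤ ∫ v in u..t, u ^ (α - γ) * (v - u) ^ (α + γ - 1) := by
          refine intervalIntegral.integral_mono_on_of_le_Ioo hut.le
            (intervalIntegrable_rpow_mul_sub_rpow hα hu ht _)
            ((intervalIntegrable_sub_rpow (by linarith) u u t).const_mul _) fun v hv => ?_
          have hv0 : 0 < v := hu.trans hv.1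
          have hvu : 0 < v - u := sub_pos.2 hv.1
          have h1 : v ^ (α - 1) = v ^ (α - γ) * v ^ (γ - 1) := by
            rw [← Real.rpow_add hv0]; ring_nf
          have h2 : v ^ (α - γ) ≤ u ^ (α - γ) :=
            Real.rpow_le_rpow_of_nonpos hu hv.1.le (by linarith)
          have h3 : v ^ (γ - 1) ≤ (v - u) ^ (γ - 1) :=
            Real.rpow_le_rpow_of_nonpos hvu (by linarith) (by linarith)
          have h4 : (v - u) ^ (α + γ - 1) = (v - u) ^ (γ - 1) * (v - u) ^ α := by
            rw [← Real.rpow_add hvu]; ring_nf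
          rw [h1, h4, ← mul_assoc]
          gcongr
      _ = u ^ (α - γ) * ((t - u) ^ (α + γ) / (α + γ)) := by
          rw [intervalIntegral.integral_const_mul, integral_sub_rpow (by linarith)]
          simp
  have hdiv : ∀ x : ℝ, u ^ (-x) * t ^ x = (t / u) ^ x := fun x => by
    rw [Real.div_rpow ht.le hu.le, Real.rpow_neg hu.le]; field_simp
  have h1t : 1 ≤ t / u := (one_le_div hu).2 hut.le
  have hA : u ^ (-α) * (t ^ α * (t - u) ^ α) ≤ (t / u) ^ γ * (t - u) ^ α := by
    rw [← mul_assoc, hdiv]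
    gcongr
  have hB : u ^ (-α) * (∫ v in u..t, v ^ (α - 1) * (v - u) ^ α) ≤
      (t / u) ^ γ * (t - u) ^ α / (α + γ) := by
    calc u ^ (-α) * (∫ v in u..t, v ^ (α - 1) * (v - u) ^ α)
        ≤ u ^ (-α) * (u ^ (α - γ) * ((t - u) ^ (α + γ) / (α + γ))) := by gcongr
      _ = u ^ (-γ) * ((t - u) ^ γ * (t - u) ^ α) / (α + γ) := by
          rw [← mul_assoc, ← Real.rpow_add hu, ← Real.rpow_add htu]; ring_nf
      _ ≤ u ^ (-γ) * (t ^ γ * (t - u) ^ α) / (α + γ) := by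
          gcongr
          linarith
      _ = (t / u) ^ γ * (t - u) ^ α / (α + γ) := by rw [← mul_assoc, hdiv]
  rw [molchanGolosovKernel_eq, abs_mul, abs_of_pos hc, mul_assoc]
  gcongr
  rw [abs_mul, abs_of_pos (Real.rpow_pos_of_pos hu _)]
  have h5 : |t ^ α * (t - u) ^ α - α * ∫ v in u..t, v ^ (α - 1) * (v - u) ^ α| ≤
      t ^ α * (t - u) ^ α + |α| * ∫ v in u..t, v ^ (α - 1) * (v - u) ^ α := by
    refine (abs_sub _ _).trans_eq ?_
    rw [abs_mul α, abs_of_nonneg hI0, abs_of_nonneg (by positivity)]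
  calc u ^ (-α) * |t ^ α * (t - u) ^ α - α * ∫ v in u..t, v ^ (α - 1) * (v - u) ^ α|
      ≤ u ^ (-α) * (t ^ α * (t - u) ^ α + |α| * ∫ v in u..t, v ^ (α - 1) * (v - u) ^ α) := by
        gcongr
    _ = u ^ (-α) * (t ^ α * (t - u) ^ α) +
        |α| * (u ^ (-α) * ∫ v in u..t, v ^ (α - 1) * (v - u) ^ α) := by ring
    _ ≤ (t / u) ^ γ * (t - u) ^ α + |α| * ((t / u) ^ γ * (t - u) ^ α / (α + γ)) := by gcongr
    _ = (1 + |α| / (α + γ)) * ((t / u) ^ γ * (t - u) ^ α) := by ring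

/-- The fundamental theorem of calculus for `v^α (v-u)^α` on `[s, t]`: the kernel's integral cancels
one half of the product rule and leaves the other. The remaining factor `(v-u)^(α-1)` is harmless
since `u < s`. -/
lemma molchanGolosovKernel_sub {c α s t u : ℝ} (hα : -1 < α) (hu : 0 < u) (hus : u < s)
    (hst : s ≤ t) :
    molchanGolosovKernel c (α + 1 / 2) t u - molchanGolosovKernel c (α + 1 / 2) s u =
      c * (u ^ (-α) * (α * ∫ v in s..t, v ^ α * (v - u) ^ (α - 1))) := by
  have hs : 0 < s := hu.trans hus
  have ht : 0 < t := hs.trans_le hst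
  have hpos : ∀ v ∈ uIcc s t, 0 < v ∧ 0 < v - u := by
    intro v hv
    rw [uIcc_of_le hst] at hv
    exact ⟨hs.trans_le hv.1, sub_pos.2 (hus.trans_le hv.1)⟩
  have hsplit : (∫ v in u..s, v ^ (α - 1) * (v - u) ^ α) + ∫ v in s..t, v ^ (α - 1) * (v - u) ^ α =
      ∫ v in u..t, v ^ (α - 1) * (v - u) ^ α :=
    intervalIntegral.integral_add_adjacent_intervals
      (intervalIntegrable_rpow_mul_sub_rpow hα hu hs _)
      (intervalIntegrable_rpow_mul_sub_rpow hα hs ht _)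
  have hint1 : IntervalIntegrable (fun v => v ^ (α - 1) * (v - u) ^ α) volume s t :=
    intervalIntegrable_rpow_mul_sub_rpow hα hs ht _
  have hint2 : IntervalIntegrable (fun v => v ^ α * (v - u) ^ (α - 1)) volume s t := by
    refine ContinuousOn.intervalIntegrable ?_
    refine ContinuousOn.mul ?_ ?_
    · exact ContinuousOn.rpow_const continuousOn_id fun x hx => Or.inl (hpos x hx).1.ne'
    · exact ContinuousOn.rpow_const (continuousOn_id.sub continuousOn_const)
        fun x hx => Or.inl (hpos x hx).2.ne'
  have hftc : ∫ v in s..t, (α * (v ^ (α - 1) * (v - u) ^ α) + α * (v ^ α * (v - u) ^ (α - 1))) =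
      t ^ α * (t - u) ^ α - s ^ α * (s - u) ^ α := by
    refine intervalIntegral.integral_eq_sub_of_hasDerivAt (f := fun v => v ^ α * (v - u) ^ α)
      (fun v hv => ?_) ((hint1.const_mul α).add (hint2.const_mul α))
    have h1 := Real.hasDerivAt_rpow_const (x := v) (p := α) (Or.inl (hpos v hv).1.ne')
    have h2 := ((hasDerivAt_id v).sub_const u).rpow_const (p := α) (Or.inl (hpos v hv).2.ne')
    refine (h1.mul h2).congr_deriv ?_
    simp only [id_eq]
    ring
  rw [intervalIntegral.integral_add (hint1.const_mul α) (hint2.const_mul α),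
    intervalIntegral.integral_const_mul, intervalIntegral.integral_const_mul] at hftc
  rw [molchanGolosovKernel_eq, molchanGolosovKernel_eq, ← hsplit]
  linear_combination (-(c * u ^ (-α))) * hftc

/-- The singularity is shared out: `(v-u)^(α-1) ≤ (s-u)^(α-θ) (v-s)^(θ-1)`, valid for `α ≤ θ ≤ 1`,
and the last factor integrates to `(t-s)^θ / θ`. The condition `t ≤ 2s` allows `v/u` to be replaced
by `2s/u`, at the cost of `2^γ ≤ 2`. -/
lemma abs_molchanGolosovKernel_sub_le {c α γ θ s t u : ℝ} (hc : 0 < c) (hα : -1 < α)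
    (hγ : |α| < γ) (hγ1 : γ ≤ 1) (hθ : 0 < θ) (hθ1 : θ ≤ 1) (hαθ : α ≤ θ) (hu : 0 < u)
    (hus : u < s) (hst : s ≤ t) (hts : t ≤ 2 * s) :
    |molchanGolosovKernel c (α + 1 / 2) t u - molchanGolosovKernel c (α + 1 / 2) s u| ≤
      c * (2 * |α| / θ) * ((t - s) ^ θ * ((s / u) ^ γ * (s - u) ^ (α - θ))) := by
  have hs : 0 < s := hu.trans hus
  have ht : 0 < t := hs.trans_le hst
  have hsu : 0 < s - u := sub_pos.2 hus
  have hγ0 : 0 ≤ γ := (abs_nonneg α).trans hγ.le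
  rw [molchanGolosovKernel_sub hα hu hus hst, abs_mul, abs_of_pos hc, mul_assoc]
  gcongr
  rw [abs_mul, abs_of_pos (Real.rpow_pos_of_pos hu _), abs_mul]
  have hJ0 : 0 ≤ ∫ v in s..t, v ^ α * (v - u) ^ (α - 1) := by
    refine intervalIntegral.integral_nonneg hst fun v hv => ?_
    have := hs.trans_le hv.1
    have : 0 ≤ v - u := by linarith [hv.1]
    positivity
  rw [abs_of_nonneg hJ0]
  have hJ : u ^ (-α) * (∫ v in s..t, v ^ α * (v - u) ^ (α - 1)) ≤
      2 * (s / u) ^ γ * (s - u) ^ (α - θ) * ((t - s) ^ θ / θ) := by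
    rw [← intervalIntegral.integral_const_mul]
    calc ∫ v in s..t, u ^ (-α) * (v ^ α * (v - u) ^ (α - 1))
        ≤ ∫ v in s..t, 2 * (s / u) ^ γ * (s - u) ^ (α - θ) * (v - s) ^ (θ - 1) := by
          refine intervalIntegral.integral_mono_on_of_le_Ioo hst ?_
            ((intervalIntegrable_sub_rpow (by linarith) s s t).const_mul _) fun v hv => ?_
          · refine IntervalIntegrable.const_mul (ContinuousOn.intervalIntegrable ?_) _
            rw [uIcc_of_le hst]
            refine ContinuousOn.mul ?_ ?_
            · exact ContinuousOn.rpow_const continuousOn_id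
                fun x hx => Or.inl (hs.trans_le hx.1).ne'
            · exact ContinuousOn.rpow_const (continuousOn_id.sub continuousOn_const)
                fun x hx => Or.inl (sub_pos.2 (hus.trans_le hx.1)).ne'
          have hv0 : 0 < v := hs.trans hv.1
          have hvs : 0 < v - s := sub_pos.2 hv.1
          have hvu : 0 < v - u := by linarith
          have h1 : u ^ (-α) * v ^ α ≤ 2 * (s / u) ^ γ := by
            calc u ^ (-α) * v ^ α = (v / u) ^ α := by
                  rw [Real.div_rpow hv0.le hu.le, Real.rpow_neg hu.le]; field_simp
              _ ≤ (v / u) ^ γ := by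
                  refine Real.rpow_le_rpow_of_exponent_le ((one_le_div hu).2 (by linarith [hv.1])) ?_
                  exact (le_abs_self α).trans hγ.le
              _ ≤ (2 * (s / u)) ^ γ := by
                  refine Real.rpow_le_rpow (by positivity) ?_ hγ0
                  rw [← mul_div_assoc]
                  gcongr
                  linarith [hv.2]
              _ = 2 ^ γ * (s / u) ^ γ := Real.mul_rpow (by norm_num) (by positivity)
              _ ≤ 2 * (s / u) ^ γ := by
                  gcongr
                  calc (2 : ℝ) ^ γ ≤ 2 ^ (1 : ℝ) :=
                        Real.rpow_le_rpow_of_exponent_le (by norm_num) hγ1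
                    _ = 2 := Real.rpow_one 2
          have h2 : (v - u) ^ (α - 1) = (v - u) ^ (α - θ) * (v - u) ^ (θ - 1) := by
            rw [← Real.rpow_add hvu]; ring_nf
          have h3 : (v - u) ^ (α - θ) ≤ (s - u) ^ (α - θ) :=
            Real.rpow_le_rpow_of_nonpos hsu (by linarith [hv.1]) (by linarith)
          have h4 : (v - u) ^ (θ - 1) ≤ (v - s) ^ (θ - 1) :=
            Real.rpow_le_rpow_of_nonpos hvs (by linarith) (by linarith)
          rw [← mul_assoc, h2, ← mul_assoc]
          gcongr
      _ = 2 * (s / u) ^ γ * (s - u) ^ (α - θ) * ((t - s) ^ θ / θ) := by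
          rw [intervalIntegral.integral_const_mul, integral_sub_rpow (by linarith)]
          simp
  calc u ^ (-α) * (|α| * ∫ v in s..t, v ^ α * (v - u) ^ (α - 1))
      = |α| * (u ^ (-α) * ∫ v in s..t, v ^ α * (v - u) ^ (α - 1)) := by ring
    _ ≤ |α| * (2 * (s / u) ^ γ * (s - u) ^ (α - θ) * ((t - s) ^ θ / θ)) := by gcongr
    _ = 2 * |α| / θ * ((t - s) ^ θ * ((s / u) ^ γ * (s - u) ^ (α - θ))) := by ring

/-- The variable lower limit is moved into an indicator, so the inner integral becomes a section
integral of a jointly measurable function. -/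
lemma aestronglyMeasurable_molchanGolosovKernel (c H t : ℝ) :
    AEStronglyMeasurable (molchanGolosovKernel c H t) (volume.restrict (Icc 0 t)) := by
  have hF : Measurable (fun p : ℝ × ℝ => {q : ℝ × ℝ | q.1 < q.2 ∧ q.2 ≤ t}.indicator
      (fun q => q.2 ^ (H - 3 / 2) * (q.2 - q.1) ^ (H - 1 / 2)) p) := by
    refine Measurable.indicator (by fun_prop) ?_
    exact (measurableSet_lt measurable_fst measurable_snd).inter
      (measurableSet_le measurable_snd measurable_const)
  have hI := (hF.stronglyMeasurable.integral_prod_right' (ν := volume)).measurable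
  refine AEStronglyMeasurable.congr (f := fun s => c * s ^ (1 / 2 - H) *
    (t ^ (H - 1 / 2) * (t - s) ^ (H - 1 / 2) - (H - 1 / 2) *
      ∫ v, {q : ℝ × ℝ | q.1 < q.2 ∧ q.2 ≤ t}.indicator
        (fun q => q.2 ^ (H - 3 / 2) * (q.2 - q.1) ^ (H - 1 / 2)) (s, v)))
    (Measurable.aestronglyMeasurable (by fun_prop)) ?_
  filter_upwards [ae_restrict_mem measurableSet_Icc] with s hs
  unfold molchanGolosovKernel
  rw [intervalIntegral.integral_of_le hs.2, ← integral_indicator measurableSet_Ioc]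
  rfl

/-! ### Square integrals of the kernel and of its increments -/

/-- On each half of `(0, t)` one of the two factors has its base in `[t/2, t]` and is comparable to
a power of `t`. This separates the two singularities of the beta integrand. -/
lemma rpow_mul_sub_rpow_le {p q t u : ℝ} (hu : 0 < u) (hut : u < t) :
    u ^ p * (t - u) ^ q ≤
      (1 + 2⁻¹ ^ p + 2⁻¹ ^ q) * (t ^ q * u ^ p + t ^ p * (t - u) ^ q) := by
  have ht : 0 < t := hu.trans hut
  have htu : 0 < t - u := sub_pos.2 hut
  -- The summand `1` serves `r ≥ 0`, the summand `2⁻¹ ^ r` serves `r ≤ 0`.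
  have key : ∀ {x r : ℝ}, 0 < x → x ≤ t → t / 2 ≤ x → x ^ r ≤ (1 + 2⁻¹ ^ r) * t ^ r := by
    intro x r hx hxt h
    rcases le_total 0 r with hr | hr
    · calc x ^ r ≤ t ^ r := by gcongr
        _ ≤ (1 + 2⁻¹ ^ r) * t ^ r := by
          refine le_mul_of_one_le_left (by positivity) ?_
          have : (0 : ℝ) ≤ 2⁻¹ ^ r := by positivity
          linarith
    · calc x ^ r ≤ (t / 2) ^ r := Real.rpow_le_rpow_of_nonpos (by positivity) h hr
        _ = 2⁻¹ ^ r * t ^ r := by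
          rw [div_eq_mul_inv, mul_comm, Real.mul_rpow (by norm_num) ht.le]
        _ ≤ (1 + 2⁻¹ ^ r) * t ^ r := by
          gcongr
          linarith
  have hp : (0 : ℝ) ≤ 2⁻¹ ^ p := by positivity
  have hq : (0 : ℝ) ≤ 2⁻¹ ^ q := by positivity
  rcases le_total (t / 2) u with h | h
  · calc u ^ p * (t - u) ^ q ≤ ((1 + 2⁻¹ ^ p) * t ^ p) * (t - u) ^ q := by
          gcongr
          exact key hu hut.le h
      _ = (1 + 2⁻¹ ^ p) * (t ^ p * (t - u) ^ q) := by ring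
      _ ≤ _ := by
          have : 0 ≤ t ^ q * u ^ p := by positivity
          exact mul_le_mul (by linarith) (by linarith) (by positivity) (by positivity)
  · calc u ^ p * (t - u) ^ q ≤ u ^ p * ((1 + 2⁻¹ ^ q) * t ^ q) := by
          gcongr
          exact key htu (by linarith) (by linarith)
      _ = (1 + 2⁻¹ ^ q) * (t ^ q * u ^ p) := by ring
      _ ≤ _ := by
          have : 0 ≤ t ^ p * (t - u) ^ q := by positivity
          exact mul_le_mul (by linarith) (by linarith) (by positivity) (by positivity)

lemma lintegral_Ioo_ofReal_eq {f : ℝ → ℝ} {a b : ℝ} (hab : a ≤ b)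
    (hf : IntervalIntegrable f volume a b) (h0 : ∀ x ∈ Ioo a b, 0 ≤ f x) :
    ∫⁻ x in Ioo a b, ENNReal.ofReal (f x) = ENNReal.ofReal (∫ x in a..b, f x) := by
  rw [intervalIntegral.integral_of_le hab, integral_Ioc_eq_integral_Ioo]
  refine (ofReal_integral_eq_lintegral_ofReal ?_ ?_).symm
  · exact ((intervalIntegrable_iff_integrableOn_Ioo_of_le hab).1 hf)
  · filter_upwards [ae_restrict_mem measurableSet_Ioo] with x hx using h0 x hx

lemma intervalIntegrable_const_sub_rpow {q : ℝ} (hq : -1 < q) (t a b : ℝ) :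
    IntervalIntegrable (fun u => (t - u) ^ q) volume a b := by
  have := (intervalIntegral.intervalIntegrable_rpow' (a := t - a) (b := t - b) hq).comp_sub_left t
  simpa using this

lemma integral_const_sub_rpow {q : ℝ} (hq : -1 < q) (s t : ℝ) :
    ∫ u in s..t, (t - u) ^ q = (t - s) ^ (q + 1) / (q + 1) := by
  rw [intervalIntegral.integral_comp_sub_left (fun x => x ^ q) t, sub_self,
    integral_rpow (Or.inl hq), Real.zero_rpow (by linarith), sub_zero]

/-- A bound for the Euler beta integral. -/
lemma lintegral_rpow_mul_sub_rpow_le {p q : ℝ} (hp : -1 < p) (hq : -1 < q) :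
    ∃ C : ℝ, 0 ≤ C ∧ ∀ t : ℝ, 0 < t →
      ∫⁻ u in Ioo 0 t, ENNReal.ofReal (u ^ p * (t - u) ^ q) ≤
        ENNReal.ofReal (C * t ^ (p + q + 1)) := by
  have hp1 : 0 < p + 1 := by linarith
  have hq1 : 0 < q + 1 := by linarith
  refine ⟨(1 + 2⁻¹ ^ p + 2⁻¹ ^ q) * (1 / (p + 1) + 1 / (q + 1)), by positivity, fun t ht => ?_⟩
  have h1 : IntervalIntegrable (fun u => t ^ q * u ^ p) volume 0 t :=
    (intervalIntegral.intervalIntegrable_rpow' hp).const_mul _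
  have h2 : IntervalIntegrable (fun u => t ^ p * (t - u) ^ q) volume 0 t :=
    (intervalIntegrable_const_sub_rpow hq t 0 t).const_mul _
  calc ∫⁻ u in Ioo 0 t, ENNReal.ofReal (u ^ p * (t - u) ^ q)
      ≤ ∫⁻ u in Ioo 0 t, ENNReal.ofReal
          ((1 + 2⁻¹ ^ p + 2⁻¹ ^ q) * (t ^ q * u ^ p + t ^ p * (t - u) ^ q)) := by
        refine setLIntegral_mono' measurableSet_Ioo fun u hu => ?_
        exact ENNReal.ofReal_le_ofReal (rpow_mul_sub_rpow_le hu.1 hu.2)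
    _ = ENNReal.ofReal (∫ u in (0 : ℝ)..t,
          (1 + 2⁻¹ ^ p + 2⁻¹ ^ q) * (t ^ q * u ^ p + t ^ p * (t - u) ^ q)) := by
        refine lintegral_Ioo_ofReal_eq ht.le ((h1.add h2).const_mul _) fun u hu => ?_
        have := hu.1
        have := sub_pos.2 hu.2
        positivity
    _ = _ := by
        rw [intervalIntegral.integral_const_mul, intervalIntegral.integral_add h1 h2,
          intervalIntegral.integral_const_mul, intervalIntegral.integral_const_mul,
          integral_rpow (Or.inl hp), integral_const_sub_rpow hq, Real.zero_rpow hp1.ne',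
          sub_zero, sub_zero]
        have h3 : t ^ q * t ^ (p + 1) = t ^ (p + q + 1) := by
          rw [← Real.rpow_add ht]; ring_nf
        have h4 : t ^ p * t ^ (q + 1) = t ^ (p + q + 1) := by
          rw [← Real.rpow_add ht]; ring_nf
        rw [mul_div_assoc', mul_div_assoc', h3, h4]
        congr 1
        ring

/-- With `|α| < γ < 1/2` the squared pointwise bound is a beta integrand with exponents `-2γ` and
`2α`, both above `-1`; the powers of `t` involving `γ` cancel. -/
lemma lintegral_molchanGolosovKernel_sq_le {c α : ℝ} (hc : 0 < c) (hα : |α| < 1 / 2) :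
    ∃ C : ℝ, 0 ≤ C ∧ ∀ t : ℝ, 0 < t →
      ∫⁻ u in Ioo 0 t, ENNReal.ofReal (molchanGolosovKernel c (α + 1 / 2) t u ^ 2) ≤
        ENNReal.ofReal (C * t ^ (2 * α + 1)) := by
  obtain ⟨γ, hγ, hγ2⟩ := exists_between hα
  have hα1 : -1 < α := by linarith [neg_abs_le α]
  obtain ⟨B, hB0, hB⟩ := lintegral_rpow_mul_sub_rpow_le (p := -2 * γ) (q := 2 * α)
    (by linarith) (by linarith [neg_abs_le α])
  set D := c * (1 + |α| / (α + γ))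
  refine ⟨D ^ 2 * B, by positivity, fun t ht => ?_⟩
  calc ∫⁻ u in Ioo 0 t, ENNReal.ofReal (molchanGolosovKernel c (α + 1 / 2) t u ^ 2)
      ≤ ∫⁻ u in Ioo 0 t, ENNReal.ofReal (D ^ 2 * t ^ (2 * γ)) *
          ENNReal.ofReal (u ^ (-2 * γ) * (t - u) ^ (2 * α)) := by
        refine setLIntegral_mono' measurableSet_Ioo fun u hu => ?_
        rw [← ENNReal.ofReal_mul (by positivity)]
        refine ENNReal.ofReal_le_ofReal ?_
        have htu := sub_pos.2 hu.2
        have h1 := abs_molchanGolosovKernel_le hc hα1 hγ (by linarith) hu.1 hu.2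
        change _ ≤ D * _ at h1
        have h2 := pow_le_pow_left₀ (abs_nonneg _) h1 2
        rw [sq_abs] at h2
        refine h2.trans_eq ?_
        rw [Real.div_rpow ht.le hu.1.le, mul_comm 2 γ, Real.rpow_mul ht.le, mul_comm 2 α,
          Real.rpow_mul htu.le, show -2 * γ = -(γ * 2) by ring, Real.rpow_neg hu.1.le,
          Real.rpow_mul hu.1.le]
        simp only [Real.rpow_ofNat]
        have := Real.rpow_pos_of_pos hu.1 γ
        field_simp
    _ = ENNReal.ofReal (D ^ 2 * t ^ (2 * γ)) *
          ∫⁻ u in Ioo 0 t, ENNReal.ofReal (u ^ (-2 * γ) * (t - u) ^ (2 * α)) := by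
        rw [lintegral_const_mul' _ _ ENNReal.ofReal_ne_top]
    _ ≤ ENNReal.ofReal (D ^ 2 * t ^ (2 * γ)) *
          ENNReal.ofReal (B * t ^ (-2 * γ + 2 * α + 1)) := by
        gcongr
        exact hB t ht
    _ = ENNReal.ofReal (D ^ 2 * B * t ^ (2 * α + 1)) := by
        rw [← ENNReal.ofReal_mul (by positivity)]
        congr 1
        have h : t ^ (2 * α + 1) = t ^ (2 * γ) * t ^ (-2 * γ + 2 * α + 1) := by
          rw [← Real.rpow_add ht]; ring_nf
        rw [h]
        ring

/-- On `(s, t)` with `t ≤ 2s` the factor `(t/u)^γ` is at most `2`, so only the singularity at `u =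
t` matters. -/
lemma lintegral_molchanGolosovKernel_sq_le_of_le {c α : ℝ} (hc : 0 < c) (hα : |α| < 1 / 2) :
    ∃ C : ℝ, 0 ≤ C ∧ ∀ s t : ℝ, 0 < s → s < t → t ≤ 2 * s →
      ∫⁻ u in Ioo s t, ENNReal.ofReal (molchanGolosovKernel c (α + 1 / 2) t u ^ 2) ≤
        ENNReal.ofReal (C * (t - s) ^ (2 * α + 1)) := by
  obtain ⟨γ, hγ, hγ2⟩ := exists_between hα
  have hα1 : -1 < α := by linarith [neg_abs_le α]
  have hγ0 : 0 ≤ γ := (abs_nonneg α).trans hγ.le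
  have hq : -1 < 2 * α := by linarith [neg_abs_le α]
  have hq1 : 0 < 2 * α + 1 := by linarith
  set D := c * (1 + |α| / (α + γ))
  have hD : 0 ≤ D := by
    have : 0 < α + γ := by linarith [neg_abs_le α]
    positivity
  refine ⟨(D * 2) ^ 2 * (1 / (2 * α + 1)), by positivity, fun s t hs hst hts => ?_⟩
  calc ∫⁻ u in Ioo s t, ENNReal.ofReal (molchanGolosovKernel c (α + 1 / 2) t u ^ 2)
      ≤ ∫⁻ u in Ioo s t, ENNReal.ofReal ((D * 2) ^ 2 * (t - u) ^ (2 * α)) := by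
        refine setLIntegral_mono' measurableSet_Ioo fun u hu => ?_
        refine ENNReal.ofReal_le_ofReal ?_
        have htu := sub_pos.2 hu.2
        have hu0 : 0 < u := hs.trans hu.1
        have h1 := abs_molchanGolosovKernel_le hc hα1 hγ (by linarith) hu0 hu.2
        have h3 : (t / u) ^ γ ≤ 2 := by
          calc (t / u) ^ γ ≤ 2 ^ γ := by
                refine Real.rpow_le_rpow (div_nonneg (by linarith) hu0.le) ?_ hγ0
                rw [div_le_iff₀ hu0]
                linarith [hu.1]
            _ ≤ 2 ^ (1 : ℝ) := Real.rpow_le_rpow_of_exponent_le (by norm_num) (by linarith)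
            _ = 2 := Real.rpow_one 2
        have h4 : |molchanGolosovKernel c (α + 1 / 2) t u| ≤ D * (2 * (t - u) ^ α) := by
          refine h1.trans ?_
          gcongr
        have h2 := pow_le_pow_left₀ (abs_nonneg _) h4 2
        rw [sq_abs] at h2
        refine h2.trans_eq ?_
        rw [mul_comm 2 α, Real.rpow_mul htu.le]
        simp only [Real.rpow_ofNat]
        ring
    _ = ENNReal.ofReal (∫ u in s..t, (D * 2) ^ 2 * (t - u) ^ (2 * α)) := by
        refine lintegral_Ioo_ofReal_eq hst.le
          ((intervalIntegrable_const_sub_rpow hq t s t).const_mul _) fun u hu => ?_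
        have := sub_pos.2 hu.2
        positivity
    _ = _ := by
        rw [intervalIntegral.integral_const_mul, integral_const_sub_rpow hq]
        congr 1
        ring

/-- The requirement `θ < α + 1/2 = H` is what makes `(s-u)^(2(α-θ))` integrable at `s`; the loss of
`ε` in this argument originates here. -/
lemma lintegral_molchanGolosovKernel_sub_sq_le {c α θ : ℝ} (hc : 0 < c) (hα : |α| < 1 / 2)
    (hθ : 0 < θ) (hαθ : α ≤ θ) (hθα : θ < α + 1 / 2) :
    ∃ C : ℝ, 0 ≤ C ∧ ∀ s t : ℝ, 0 < s → s < t → t ≤ 2 * s →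
      ∫⁻ u in Ioo 0 s, ENNReal.ofReal ((molchanGolosovKernel c (α + 1 / 2) t u -
        molchanGolosovKernel c (α + 1 / 2) s u) ^ 2) ≤
        ENNReal.ofReal (C * s ^ (2 * α + 1 - 2 * θ) * (t - s) ^ (2 * θ)) := by
  obtain ⟨γ, hγ, hγ2⟩ := exists_between hα
  have hα1 : -1 < α := by linarith [neg_abs_le α]
  have hθ1 : θ ≤ 1 := by linarith [le_abs_self α]
  obtain ⟨B, hB0, hB⟩ := lintegral_rpow_mul_sub_rpow_le (p := -2 * γ) (q := 2 * (α - θ))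
    (by linarith) (by linarith)
  set D := c * (2 * |α| / θ)
  refine ⟨D ^ 2 * B, by positivity, fun s t hs hst hts => ?_⟩
  have hts0 : 0 < t - s := sub_pos.2 hst
  calc ∫⁻ u in Ioo 0 s, ENNReal.ofReal ((molchanGolosovKernel c (α + 1 / 2) t u -
        molchanGolosovKernel c (α + 1 / 2) s u) ^ 2)
      ≤ ∫⁻ u in Ioo 0 s, ENNReal.ofReal (D ^ 2 * s ^ (2 * γ) * (t - s) ^ (2 * θ)) *
          ENNReal.ofReal (u ^ (-2 * γ) * (s - u) ^ (2 * (α - θ))) := by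
        refine setLIntegral_mono' measurableSet_Ioo fun u hu => ?_
        rw [← ENNReal.ofReal_mul (by positivity)]
        refine ENNReal.ofReal_le_ofReal ?_
        have hsu := sub_pos.2 hu.2
        have h1 := abs_molchanGolosovKernel_sub_le hc hα1 hγ (by linarith) hθ hθ1 hαθ hu.1 hu.2
          hst.le hts
        change _ ≤ D * _ at h1
        have h2 := pow_le_pow_left₀ (abs_nonneg _) h1 2
        rw [sq_abs] at h2
        refine h2.trans_eq ?_
        rw [Real.div_rpow hs.le hu.1.le, mul_comm 2 γ, Real.rpow_mul hs.le, mul_comm 2 (α - θ),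
          Real.rpow_mul hsu.le, show -2 * γ = -(γ * 2) by ring, Real.rpow_neg hu.1.le,
          Real.rpow_mul hu.1.le, mul_comm 2 θ, Real.rpow_mul hts0.le]
        simp only [Real.rpow_ofNat]
        have := Real.rpow_pos_of_pos hu.1 γ
        field_simp
    _ = ENNReal.ofReal (D ^ 2 * s ^ (2 * γ) * (t - s) ^ (2 * θ)) *
          ∫⁻ u in Ioo 0 s, ENNReal.ofReal (u ^ (-2 * γ) * (s - u) ^ (2 * (α - θ))) := by
        rw [lintegral_const_mul' _ _ ENNReal.ofReal_ne_top]
    _ ≤ ENNReal.ofReal (D ^ 2 * s ^ (2 * γ) * (t - s) ^ (2 * θ)) *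
          ENNReal.ofReal (B * s ^ (-2 * γ + 2 * (α - θ) + 1)) := by
        gcongr
        exact hB s hs
    _ = ENNReal.ofReal (D ^ 2 * B * s ^ (2 * α + 1 - 2 * θ) * (t - s) ^ (2 * θ)) := by
        rw [← ENNReal.ofReal_mul (by positivity)]
        congr 1
        have h : s ^ (2 * α + 1 - 2 * θ) = s ^ (2 * γ) * s ^ (-2 * γ + 2 * (α - θ) + 1) := by
          rw [← Real.rpow_add hs]; ring_nf
        rw [h]
        ring

lemma rpow_le_rpow_sub_mul_rpow {x T a b : ℝ} (hx : 0 < x) (hxT : x ≤ T) (hba : b ≤ a) :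
    x ^ a ≤ T ^ (a - b) * x ^ b := by
  calc x ^ a = x ^ (a - b) * x ^ b := by rw [← Real.rpow_add hx, sub_add_cancel]
    _ ≤ T ^ (a - b) * x ^ b := by
      gcongr

lemma memLp_two_of_lintegral_sq {α : Type*} [MeasurableSpace α] {m : Measure α} {f : α → ℝ}
    (hf : AEStronglyMeasurable f m) (h : ∫⁻ x, ENNReal.ofReal (f x ^ 2) ∂m < ∞) :
    MemLp f 2 m := by
  refine ⟨hf, ?_⟩
  rw [← eLpNorm_two_sq] at h
  by_contra! h1
  rw [top_le_iff.1 h1] at h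
  simp at h

lemma lintegral_molchanGolosovKernel_increment_sq_le {c H T θ : ℝ} (hc : 0 < c)
    (hH : H ∈ Ioo (0 : ℝ) 1) (hT : 0 < T) (hθ : 0 < θ) (hθH : θ < H) :
    ∃ C : ℝ, 0 < C ∧ ∀ s t : ℝ, 0 ≤ s → s < t → t ≤ T →
      ∫⁻ u in Icc 0 t, ENNReal.ofReal ((molchanGolosovKernel c H t u -
        (Icc 0 s).indicator (molchanGolosovKernel c H s) u) ^ 2) ≤
      ENNReal.ofReal (C * (t - s) ^ (2 * θ)) := by
  obtain ⟨α, rfl⟩ : ∃ α, H = α + 1 / 2 := ⟨H - 1 / 2, by ring⟩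
  have hα : |α| < 1 / 2 := by rw [abs_lt]; constructor <;> linarith [hH.1, hH.2]
  set k := molchanGolosovKernel c (α + 1 / 2) with hk
  -- The pointwise increment bound needs an exponent at least `α`; surplus powers of `t - s` are
  -- absorbed into powers of `T`.
  set θ' := max θ α with hθ'
  have hθ'0 : 0 < θ' := hθ.trans_le (le_max_left _ _)
  have hθ'H : θ' < α + 1 / 2 := max_lt hθH (by linarith)
  obtain ⟨A, hA0, hA⟩ := lintegral_molchanGolosovKernel_sq_le hc hα
  obtain ⟨B, hB0, hB⟩ := lintegral_molchanGolosovKernel_sq_le_of_le hc hα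
  obtain ⟨D, hD0, hD⟩ := lintegral_molchanGolosovKernel_sub_sq_le hc hα hθ'0 (le_max_right _ _)
    hθ'H
  rw [← hk] at hA hB hD
  set Q := T ^ (2 * α + 1 - 2 * θ) with hQ
  set R := T ^ (2 * α + 1 - 2 * θ') * T ^ (2 * θ' - 2 * θ) with hR
  have hQ0 : 0 < Q := by positivity
  have hR0 : 0 < R := by positivity
  -- The first summand serves `t > 2s`, the next two `t ≤ 2s`; the `1` ensures positivity.
  refine ⟨4 * A * 2 ^ (2 * α + 1) * Q + D * R + B * Q + 1, by positivity,
    fun s t hs hst htT => ?_⟩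
  have ht : 0 < t := hs.trans_lt hst
  have hts : 0 < t - s := sub_pos.2 hst
  have hQ' : (t - s) ^ (2 * α + 1) ≤ Q * (t - s) ^ (2 * θ) :=
    rpow_le_rpow_sub_mul_rpow hts (by linarith) (by linarith)
  have hpos : 0 < (t - s) ^ (2 * θ) := Real.rpow_pos_of_pos hts _
  rw [← setLIntegral_congr (Ioo_ae_eq_Icc (a := (0 : ℝ)) (b := t))]
  rcases le_or_gt t (2 * s) with h | h
  · have hs0 : 0 < s := by linarith
    have hset : (Ioo 0 t : Set ℝ) ⊆ Ioc 0 s ∪ Ioo s t := by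
      intro u hu
      rcases le_or_gt u s with h | h
      · exact Or.inl ⟨hu.1, h⟩
      · exact Or.inr ⟨h, hu.2⟩
    refine (lintegral_mono_set hset).trans ((lintegral_union_le _ _ _).trans ?_)
    rw [← setLIntegral_congr (Ioo_ae_eq_Ioc (a := (0 : ℝ)) (b := s))]
    have h1 : ∫⁻ u in Ioo 0 s, ENNReal.ofReal ((k t u - (Icc 0 s).indicator (k s) u) ^ 2) ≤
        ENNReal.ofReal (D * s ^ (2 * α + 1 - 2 * θ') * (t - s) ^ (2 * θ')) := by
      refine le_trans (le_of_eq ?_) (hD s t hs0 hst h)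
      refine setLIntegral_congr_fun measurableSet_Ioo fun u hu => ?_
      simp only [indicator_of_mem (Ioo_subset_Icc_self hu)]
    have h2 : ∫⁻ u in Ioo s t, ENNReal.ofReal ((k t u - (Icc 0 s).indicator (k s) u) ^ 2) ≤
        ENNReal.ofReal (B * (t - s) ^ (2 * α + 1)) := by
      refine le_trans (le_of_eq ?_) (hB s t hs0 hst h)
      refine setLIntegral_congr_fun measurableSet_Ioo fun u hu => ?_
      simp only [indicator_of_notMem (fun hmem : u ∈ Icc 0 s => hmem.2.not_gt hu.1), sub_zero]
    refine (add_le_add h1 h2).trans ?_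
    rw [← ENNReal.ofReal_add (by positivity) (by positivity)]
    refine ENNReal.ofReal_le_ofReal ?_
    have h3 : s ^ (2 * α + 1 - 2 * θ') ≤ T ^ (2 * α + 1 - 2 * θ') :=
      Real.rpow_le_rpow hs (by linarith) (by linarith)
    have h4 : (t - s) ^ (2 * θ') ≤ T ^ (2 * θ' - 2 * θ) * (t - s) ^ (2 * θ) :=
      rpow_le_rpow_sub_mul_rpow hts (by linarith) (by linarith [le_max_left θ α])
    calc D * s ^ (2 * α + 1 - 2 * θ') * (t - s) ^ (2 * θ') + B * (t - s) ^ (2 * α + 1)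
        ≤ D * T ^ (2 * α + 1 - 2 * θ') * (T ^ (2 * θ' - 2 * θ) * (t - s) ^ (2 * θ)) +
          B * (Q * (t - s) ^ (2 * θ)) := by gcongr
      _ = (D * R + B * Q) * (t - s) ^ (2 * θ) := by rw [hR]; ring
      _ ≤ _ := by
        have : 0 ≤ 4 * A * 2 ^ (2 * α + 1) * Q := by positivity
        exact mul_le_mul_of_nonneg_right (by linarith) hpos.le
  -- Here `t < 2(t - s)`, so the two kernels are bounded separately by `t^(2α+1)`.
  · have hA' : ∀ r : ℝ, 0 ≤ r → r ≤ t → ∫⁻ u in Ioo 0 r, ENNReal.ofReal (k r u ^ 2) ≤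
        ENNReal.ofReal (A * t ^ (2 * α + 1)) := by
      intro r hr hrt
      rcases hr.eq_or_lt with rfl | hr
      · simp
      · refine (hA r hr).trans (ENNReal.ofReal_le_ofReal ?_)
        gcongr
        linarith [neg_abs_le α]
    have hmeas : AEMeasurable (fun u => 2 * ENNReal.ofReal (k t u ^ 2))
        (volume.restrict (Ioo 0 t)) := by
      have := ((aestronglyMeasurable_molchanGolosovKernel c (α + 1 / 2) t).mono_measure
        (Measure.restrict_mono Ioo_subset_Icc_self le_rfl)).aemeasurable
      fun_prop
    calc ∫⁻ u in Ioo 0 t, ENNReal.ofReal ((k t u - (Icc 0 s).indicator (k s) u) ^ 2)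
        ≤ ∫⁻ u in Ioo 0 t, (2 * ENNReal.ofReal (k t u ^ 2) +
            2 * (Icc 0 s).indicator (fun u => ENNReal.ofReal (k s u ^ 2)) u) := by
          refine lintegral_mono fun u => ?_
          have h1 : (Icc 0 s).indicator (fun u => ENNReal.ofReal (k s u ^ 2)) u =
              ENNReal.ofReal ((Icc 0 s).indicator (k s) u ^ 2) := by
            simp only [indicator]
            split_ifs <;> simp
          simp only
          rw [h1, ← mul_add, ← ENNReal.ofReal_add (sq_nonneg _) (sq_nonneg _),
            ← ENNReal.ofReal_ofNat, ← ENNReal.ofReal_mul (by norm_num)]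
          refine ENNReal.ofReal_le_ofReal ?_
          nlinarith [sq_nonneg (k t u + (Icc 0 s).indicator (k s) u)]
      _ = 2 * (∫⁻ u in Ioo 0 t, ENNReal.ofReal (k t u ^ 2)) +
            2 * ∫⁻ u in Ioo 0 t, (Icc 0 s).indicator (fun u => ENNReal.ofReal (k s u ^ 2)) u := by
          rw [lintegral_add_left' hmeas, lintegral_const_mul' _ _ (by norm_num),
            lintegral_const_mul' _ _ (by norm_num)]
      _ ≤ 2 * ENNReal.ofReal (A * t ^ (2 * α + 1)) + 2 * ENNReal.ofReal (A * t ^ (2 * α + 1)) := by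
          gcongr
          · exact hA' t ht.le le_rfl
          · refine (setLIntegral_le_lintegral _ _).trans ?_
            rw [lintegral_indicator measurableSet_Icc,
              ← setLIntegral_congr (Ioo_ae_eq_Icc (a := (0 : ℝ)) (b := s))]
            exact hA' s hs hst.le
      _ = ENNReal.ofReal (4 * (A * t ^ (2 * α + 1))) := by
          generalize A * t ^ (2 * α + 1) = x
          rw [← add_mul, ENNReal.ofReal_mul (by norm_num)]
          norm_num
      _ ≤ _ := by
          refine ENNReal.ofReal_le_ofReal ?_
          have h1 : t ^ (2 * α + 1) ≤ 2 ^ (2 * α + 1) * (t - s) ^ (2 * α + 1) := by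
            rw [← Real.mul_rpow (by norm_num) hts.le]
            exact Real.rpow_le_rpow ht.le (by linarith) (by linarith [neg_abs_le α])
          calc 4 * (A * t ^ (2 * α + 1))
              ≤ 4 * (A * (2 ^ (2 * α + 1) * (Q * (t - s) ^ (2 * θ)))) := by
                gcongr
                exact h1.trans (by gcongr)
            _ = (4 * A * 2 ^ (2 * α + 1) * Q) * (t - s) ^ (2 * θ) := by ring
            _ ≤ _ := by
              have h2 : 0 ≤ D * R := by positivity
              have h3 : 0 ≤ B * Q := by positivity
              exact mul_le_mul_of_nonneg_right (by linarith) hpos.le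

lemma memLp_molchanGolosovKernel {c H : ℝ} (hc : 0 < c) (hH : H ∈ Ioo (0 : ℝ) 1) (t : ℝ≥0) :
    MemLp (molchanGolosovKernel c H t) 2 (volume.restrict (Icc (0 : ℝ) t)) := by
  refine memLp_two_of_lintegral_sq (aestronglyMeasurable_molchanGolosovKernel c H t) ?_
  rcases (zero_le : 0 ≤ t).eq_or_lt with rfl | ht
  · simp
  obtain ⟨α, rfl⟩ : ∃ α, H = α + 1 / 2 := ⟨H - 1 / 2, by ring⟩
  have hα : |α| < 1 / 2 := by rw [abs_lt]; constructor <;> linarith [hH.1, hH.2]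
  obtain ⟨A, -, hA⟩ := lintegral_molchanGolosovKernel_sq_le hc hα
  rw [← setLIntegral_congr (Ioo_ae_eq_Icc (a := (0 : ℝ)) (b := t))]
  exact (hA t ht).trans_lt ENNReal.ofReal_lt_top

/-- The kernel of an increment is square integrable, and its norm is a Hölder function of the
increment of every order below the Hurst index. -/
theorem exists_integral_molchanGolosovKernel_increment_sq_le {c H θ : ℝ} {T : ℝ≥0} (hc : 0 < c)
    (hH : H ∈ Ioo (0 : ℝ) 1) (hT : 0 < T) (hθ : 0 < θ) (hθH : θ < H) :
    ∃ C : ℝ, 0 < C ∧ ∀ s t : ℝ≥0, s < t → t ≤ T →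
      MemLp (fun u => molchanGolosovKernel c H t u -
        (Icc (0 : ℝ) s).indicator (molchanGolosovKernel c H s) u) 2
        (volume.restrict (Icc (0 : ℝ) t)) ∧
      ∫ u in Icc (0 : ℝ) t, (molchanGolosovKernel c H t u -
        (Icc (0 : ℝ) s).indicator (molchanGolosovKernel c H s) u) ^ 2 ≤
        C * ((t : ℝ) - s) ^ (2 * θ) := by
  obtain ⟨C, hC, h⟩ := lintegral_molchanGolosovKernel_increment_sq_le hc hH (T := T)
    (by exact_mod_cast hT) hθ hθH
  refine ⟨C, hC, fun s t hst htT => ?_⟩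
  have hst' : (s : ℝ) < t := by exact_mod_cast hst
  have hle := h s t s.2 hst' (by exact_mod_cast htT)
  have hmem : MemLp (fun u => molchanGolosovKernel c H t u -
        (Icc (0 : ℝ) s).indicator (molchanGolosovKernel c H s) u) 2
        (volume.restrict (Icc (0 : ℝ) t)) := by
    refine memLp_two_of_lintegral_sq ?_ (hle.trans_lt ENNReal.ofReal_lt_top)
    refine (aestronglyMeasurable_molchanGolosovKernel c H t).sub ?_
    rw [aestronglyMeasurable_indicator_iff measurableSet_Icc,
      Measure.restrict_restrict_of_subset (Icc_subset_Icc_right hst'.le)]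
    exact aestronglyMeasurable_molchanGolosovKernel c H s
  refine ⟨hmem, ?_⟩
  rw [← ofReal_integral_eq_lintegral_ofReal hmem.integrable_sq
    (ae_of_all _ fun x => sq_nonneg _)] at hle
  refine (ENNReal.ofReal_le_ofReal_iff ?_).1 hle
  have : 0 ≤ (t : ℝ) - s := by linarith
  positivity

/-! ### The Kolmogorov–Chentsov theorem -/

section Dyadic

variable {F : ℕ → ℕ → ℝ} {M κ : ℝ}

lemma floor_two_pow_succ_mul (n : ℕ) {x : ℝ} (hx : 0 ≤ x) :
    ⌊2 ^ (n + 1) * x⌋₊ = 2 * ⌊2 ^ n * x⌋₊ ∨ ⌊2 ^ (n + 1) * x⌋₊ = 2 * ⌊2 ^ n * x⌋₊ + 1 := by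
  have h0 : 0 ≤ 2 ^ n * x := by positivity
  have h1 := Nat.floor_le h0
  have h2 := Nat.lt_floor_add_one (2 ^ n * x)
  have h3 : 2 * ⌊2 ^ n * x⌋₊ ≤ ⌊2 ^ (n + 1) * x⌋₊ := by
    refine Nat.le_floor ?_
    push_cast
    rw [pow_succ]
    linarith
  have h4 : ⌊2 ^ (n + 1) * x⌋₊ < 2 * ⌊2 ^ n * x⌋₊ + 2 := by
    rw [Nat.floor_lt (by positivity)]
    push_cast
    rw [pow_succ]
    linarith
  omega

lemma floor_two_pow_mul_le (n : ℕ) {x : ℝ} (hx1 : x ≤ 1) : ⌊2 ^ n * x⌋₊ ≤ 2 ^ n := by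
  refine Nat.floor_le_of_le ?_
  push_cast
  exact mul_le_of_le_one_right (by positivity) hx1

/-- `F n k` stands for the value at `k / 2^n`. Refining the dyadic approximation of `x` either keeps
the point or moves one step to the right at level `n + 1`. -/
lemma dist_dyadic_succ_le (hκ : 0 < κ) (hF : ∀ n k, F (n + 1) (2 * k) = F n k) (hM : 0 ≤ M)
    (h : ∀ n k, k < 2 ^ n → |F n (k + 1) - F n k| ≤ M * (2 ^ (-κ)) ^ n) {x : ℝ} (hx : 0 ≤ x)
    (hx1 : x ≤ 1) (n : ℕ) :
    dist (F n ⌊2 ^ n * x⌋₊) (F (n + 1) ⌊2 ^ (n + 1) * x⌋₊) ≤ M * (2 ^ (-κ)) ^ n := by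
  have hρ : (2 : ℝ) ^ (-κ) ≤ 1 := Real.rpow_le_one_of_one_le_of_nonpos (by norm_num) (by linarith)
  have hle := floor_two_pow_mul_le (n + 1) hx1
  rw [dist_comm, Real.dist_eq]
  rcases floor_two_pow_succ_mul n hx with h1 | h1
  · rw [h1, hF, sub_self, abs_zero]
    positivity
  · rw [h1, ← hF n]
    refine (h (n + 1) _ (by omega)).trans ?_
    gcongr _ * ?_
    exact pow_le_pow_of_le_one (by positivity) hρ (Nat.le_succ n)

lemma exists_tendsto_dyadic (hκ : 0 < κ) (hF : ∀ n k, F (n + 1) (2 * k) = F n k) (hM : 0 ≤ M)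
    (h : ∀ n k, k < 2 ^ n → |F n (k + 1) - F n k| ≤ M * (2 ^ (-κ)) ^ n) {x : ℝ} (hx : 0 ≤ x)
    (hx1 : x ≤ 1) : ∃ l, Tendsto (fun n => F n ⌊2 ^ n * x⌋₊) atTop (𝓝 l) :=
  cauchySeq_tendsto_of_complete (cauchySeq_of_le_geometric _ M
    (Real.rpow_lt_one_of_one_lt_of_neg (by norm_num) (by linarith))
    (dist_dyadic_succ_le hκ hF hM h hx hx1))

/-- Points at distance at most `2⁻ⁿ` have level-`n` approximations that coincide or are neighbours.
-/
lemma abs_dyadic_sub_le (hM : 0 ≤ M)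
    (h : ∀ n k, k < 2 ^ n → |F n (k + 1) - F n k| ≤ M * (2 ^ (-κ)) ^ n) {x y : ℝ} (hx : 0 ≤ x)
    (hxy : x ≤ y) (hy1 : y ≤ 1) {n : ℕ} (hn : y - x ≤ (1 / 2) ^ n) :
    |F n ⌊2 ^ n * y⌋₊ - F n ⌊2 ^ n * x⌋₊| ≤ M * (2 ^ (-κ)) ^ n := by
  have hle := floor_two_pow_mul_le n hy1
  have h1 : ⌊2 ^ n * x⌋₊ ≤ ⌊2 ^ n * y⌋₊ := Nat.floor_le_floor (by gcongr)
  have h2 : ⌊2 ^ n * y⌋₊ ≤ ⌊2 ^ n * x⌋₊ + 1 := by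
    rw [← Nat.floor_add_one (by positivity)]
    refine Nat.floor_le_floor ?_
    have h3 : (2 : ℝ) ^ n * (y - x) ≤ 2 ^ n * (1 / 2) ^ n := by gcongr
    rw [← mul_pow] at h3
    norm_num at h3
    linarith
  rcases h1.eq_or_lt with h3 | h3
  · rw [h3, sub_self, abs_zero]
    positivity
  · have h4 : ⌊2 ^ n * y⌋₊ = ⌊2 ^ n * x⌋₊ + 1 := by omega
    rw [h4]
    exact h n _ (by omega)

/-- Chaining at the level `n` with `2^{-(n+1)} < y - x ≤ 2^{-n}`: two geometric tails and one
neighbour step. Passing from `2^{-n}` to `y - x` costs the factor `2^κ`. -/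
lemma abs_sub_le_of_tendsto_dyadic (hκ : 0 < κ) (hF : ∀ n k, F (n + 1) (2 * k) = F n k)
    (hM : 0 ≤ M) (h : ∀ n k, k < 2 ^ n → |F n (k + 1) - F n k| ≤ M * (2 ^ (-κ)) ^ n) {L : ℝ → ℝ}
    (hL : ∀ x, 0 ≤ x → x ≤ 1 → Tendsto (fun n => F n ⌊2 ^ n * x⌋₊) atTop (𝓝 (L x))) {x y : ℝ}
    (hx : 0 ≤ x) (hxy : x ≤ y) (hy1 : y ≤ 1) :
    |L y - L x| ≤ M * (1 + 2 / (1 - 2 ^ (-κ))) * 2 ^ κ * (y - x) ^ κ := by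
  have hρ : (2 : ℝ) ^ (-κ) < 1 := Real.rpow_lt_one_of_one_lt_of_neg (by norm_num) (by linarith)
  have hρ' : 0 < 1 - (2 : ℝ) ^ (-κ) := sub_pos.2 hρ
  rcases hxy.eq_or_lt with rfl | hlt
  · rw [sub_self, sub_self, abs_zero, Real.zero_rpow hκ.ne', mul_zero]
  obtain ⟨n, hn1, hn2⟩ := exists_nat_pow_near_of_lt_one (sub_pos.2 hlt) (by linarith)
    (y := (1 / 2 : ℝ)) (by norm_num) (by norm_num)
  have hdx := dist_le_of_le_geometric_of_tendsto _ M hρ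
    (dist_dyadic_succ_le hκ hF hM h hx (hxy.trans hy1)) (hL x hx (hxy.trans hy1)) n
  have hdy := dist_le_of_le_geometric_of_tendsto _ M hρ
    (dist_dyadic_succ_le hκ hF hM h (hx.trans hxy) hy1) (hL y (hx.trans hxy) hy1) n
  have hd := abs_dyadic_sub_le hM h hx hxy hy1 hn2
  have hpow : ((2 : ℝ) ^ (-κ)) ^ n ≤ 2 ^ κ * (y - x) ^ κ := by
    have h1 : ((2 : ℝ) ^ (-κ)) ^ n = 2 ^ κ * ((1 / 2 : ℝ) ^ (n + 1)) ^ κ := by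
      rw [← Real.rpow_natCast, ← Real.rpow_mul (by norm_num), one_div, inv_pow, ← Real.rpow_natCast,
        ← Real.rpow_neg (by norm_num), ← Real.rpow_mul (by norm_num), ← Real.rpow_add (by norm_num)]
      push_cast
      ring_nf
    rw [h1]
    gcongr
  rw [Real.dist_eq, abs_sub_comm] at hdy
  rw [Real.dist_eq] at hdx
  have htri : |L y - L x| ≤ |L y - F n ⌊2 ^ n * y⌋₊| +
      |F n ⌊2 ^ n * y⌋₊ - F n ⌊2 ^ n * x⌋₊| + |F n ⌊2 ^ n * x⌋₊ - L x| := by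
    have := abs_add_three (L y - F n ⌊2 ^ n * y⌋₊) (F n ⌊2 ^ n * y⌋₊ - F n ⌊2 ^ n * x⌋₊)
      (F n ⌊2 ^ n * x⌋₊ - L x)
    simpa using this
  calc |L y - L x| ≤ M * (2 ^ (-κ)) ^ n / (1 - 2 ^ (-κ)) + M * (2 ^ (-κ)) ^ n +
        M * (2 ^ (-κ)) ^ n / (1 - 2 ^ (-κ)) := by linarith
    _ = M * (1 + 2 / (1 - 2 ^ (-κ))) * (2 ^ (-κ)) ^ n := by ring
    _ ≤ M * (1 + 2 / (1 - 2 ^ (-κ))) * (2 ^ κ * (y - x) ^ κ) := by gcongr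
    _ = _ := by ring

end Dyadic

lemma holderOnWith_of_abs_sub_le {f : ℝ≥0 → ℝ} {C κ : ℝ≥0} {s : Set ℝ≥0}
    (h : ∀ x ∈ s, ∀ y ∈ s, x ≤ y → |f y - f x| ≤ C * ((y : ℝ) - x) ^ (κ : ℝ)) :
    HolderOnWith C κ f s := by
  have key : ∀ x ∈ s, ∀ y ∈ s, x ≤ y → edist (f x) (f y) ≤ C * edist x y ^ (κ : ℝ) := by
    intro x hx y hy hxy
    have hxy' : (x : ℝ) ≤ y := hxy
    rw [edist_nndist, edist_nndist, ← ENNReal.coe_rpow_of_nonneg _ (NNReal.coe_nonneg κ), ← ENNReal.coe_mul,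
      ENNReal.coe_le_coe, ← NNReal.coe_le_coe]
    push_cast
    rw [dist_comm, Real.dist_eq, dist_comm x y, NNReal.dist_eq,
      abs_of_nonneg (sub_nonneg.2 hxy')]
    exact h x hx y hy hxy
  intro x hx y hy
  rcases le_total x y with hxy | hxy
  · exact key x hx y hy hxy
  · rw [edist_comm, edist_comm x]
    exact key y hy x hx hxy

section Kolmogorov

variable {Ω : Type*} [MeasurableSpace Ω] {P : Measure Ω} {T : ℝ≥0} {W : ℝ≥0 → Ω → ℝ}

/-- The sum `S` of all `2^{κpn} |Δ n k|^p` has finite expectation: level `n` has `2^n` increments,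
so the ratio is `2^{1+pκ-θ} < 1`. Where `S` is finite, `M = S^{1/p}` works for every `n` and `k`. -/
lemma ae_exists_dyadic_bound (hT : 0 < T) (hW : ∀ t, Measurable (W t)) {κ p θ C : ℝ}
    (hp : 0 < p) (hθ : 1 + p * κ < θ) (hC : 0 ≤ C)
    (h : ∀ s t : ℝ≥0, s < t → t ≤ T →
      ∫⁻ ω, ENNReal.ofReal (|W t ω - W s ω| ^ p) ∂P ≤ ENNReal.ofReal (C * ((t : ℝ) - s) ^ θ)) :
    ∀ᵐ ω ∂P, ∃ M : ℝ, 0 ≤ M ∧ ∀ n k : ℕ, k < 2 ^ n →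
      |W ((k + 1 : ℕ) * T / 2 ^ n) ω - W (k * T / 2 ^ n) ω| ≤ M * (2 ^ (-κ)) ^ n := by
  set Δ : ℕ → ℕ → Ω → ℝ := fun n k ω => W ((k + 1 : ℕ) * T / 2 ^ n) ω - W (k * T / 2 ^ n) ω
  set b : ℝ := 2 ^ (κ * p) with hb
  have hb0 : 0 < b := by positivity
  set S : Ω → ℝ≥0∞ := fun ω => ∑' n : ℕ, ∑ k ∈ Finset.range (2 ^ n),
    ENNReal.ofReal (b ^ n) * ENNReal.ofReal (|Δ n k ω| ^ p) with hS
  have hΔm : ∀ n k, Measurable (fun ω => ENNReal.ofReal (|Δ n k ω| ^ p)) := by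
    intro n k
    have h1 := hW ((k + 1 : ℕ) * T / 2 ^ n)
    have h2 := hW (k * T / 2 ^ n)
    exact ENNReal.measurable_ofReal.comp ((h1.sub h2).abs.pow_const p)
  have hSm : Measurable S := by
    refine Measurable.tsum fun n => Finset.measurable_sum _ fun k _ => ?_
    exact (hΔm n k).const_mul _
  have hstep : ∀ n k : ℕ, k < 2 ^ n →
      ∫⁻ ω, ENNReal.ofReal (|Δ n k ω| ^ p) ∂P ≤ ENNReal.ofReal (C * ((T : ℝ) / 2 ^ n) ^ θ) := by
    intro n k hk
    have h1 : (k * T / 2 ^ n : ℝ≥0) < (k + 1 : ℕ) * T / 2 ^ n := by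
      gcongr
      exact Nat.lt_succ_self k
    have h2 : ((k + 1 : ℕ) * T / 2 ^ n : ℝ≥0) ≤ T := by
      rw [div_le_iff₀ (by positivity), mul_comm]
      gcongr
      exact_mod_cast hk
    refine (h _ _ h1 h2).trans_eq ?_
    congr 3
    push_cast
    ring
  set q : ℝ := 2 * b * (2 ^ (-θ)) with hq
  have hq0 : 0 < q := by positivity
  have hq1 : q < 1 := by
    have : q = 2 ^ (1 + p * κ - θ) := by
      rw [hq, hb, sub_eq_add_neg, Real.rpow_add (by norm_num), Real.rpow_add (by norm_num),
        Real.rpow_one, mul_comm p κ]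
    rw [this]
    exact Real.rpow_lt_one_of_one_lt_of_neg (by norm_num) (by linarith)
  have hSint : ∫⁻ ω, S ω ∂P < ∞ := by
    calc ∫⁻ ω, S ω ∂P = ∑' n : ℕ, ∑ k ∈ Finset.range (2 ^ n),
          ENNReal.ofReal (b ^ n) * ∫⁻ ω, ENNReal.ofReal (|Δ n k ω| ^ p) ∂P := by
          rw [hS, lintegral_tsum fun n => (Finset.measurable_sum _ fun k _ =>
            (hΔm n k).const_mul _).aemeasurable]
          refine tsum_congr fun n => ?_
          rw [lintegral_finsetSum _ fun k _ => (hΔm n k).const_mul _]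
          refine Finset.sum_congr rfl fun k _ => ?_
          rw [lintegral_const_mul _ (hΔm n k)]
      _ ≤ ∑' n : ℕ, ENNReal.ofReal (C * (T : ℝ) ^ θ * q ^ n) := by
          refine ENNReal.tsum_le_tsum fun n => ?_
          calc ∑ k ∈ Finset.range (2 ^ n),
                ENNReal.ofReal (b ^ n) * ∫⁻ ω, ENNReal.ofReal (|Δ n k ω| ^ p) ∂P
              ≤ ∑ k ∈ Finset.range (2 ^ n),
                ENNReal.ofReal (b ^ n) * ENNReal.ofReal (C * ((T : ℝ) / 2 ^ n) ^ θ) := by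
                refine Finset.sum_le_sum fun k hk => ?_
                gcongr
                exact hstep n k (Finset.mem_range.1 hk)
            _ = ENNReal.ofReal (C * (T : ℝ) ^ θ * q ^ n) := by
                rw [Finset.sum_const, Finset.card_range, nsmul_eq_mul,
                  ← ENNReal.ofReal_mul (by positivity), ← ENNReal.ofReal_natCast,
                  ← ENNReal.ofReal_mul (by positivity)]
                congr 1
                have h1 : ((T : ℝ) / 2 ^ n) ^ θ = (T : ℝ) ^ θ * (2 ^ (-θ)) ^ n := by
                  rw [Real.div_rpow (NNReal.coe_nonneg T) (by positivity), div_eq_mul_inv,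
                    ← Real.rpow_natCast, ← Real.rpow_natCast, ← Real.rpow_mul (by norm_num),
                    ← Real.rpow_mul (by norm_num), ← Real.rpow_neg (by norm_num)]
                  ring_nf
                rw [h1, hq, mul_pow, mul_pow]
                push_cast
                ring
      _ < ∞ := (Summable.mul_left _ (summable_geometric_of_lt_one hq0.le hq1)).tsum_ofReal_lt_top
  filter_upwards [ae_lt_top hSm hSint.ne] with ω hω
  refine ⟨(S ω).toReal ^ p⁻¹, by positivity, fun n k hk => ?_⟩
  change |Δ n k ω| ≤ _
  have h1 : ENNReal.ofReal (b ^ n) * ENNReal.ofReal (|Δ n k ω| ^ p) ≤ S ω := by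
    refine le_trans ?_ (ENNReal.le_tsum n)
    exact Finset.single_le_sum (f := fun k => ENNReal.ofReal (b ^ n) *
      ENNReal.ofReal (|Δ n k ω| ^ p)) (fun _ _ => zero_le) (Finset.mem_range.2 hk)
  rw [← ENNReal.ofReal_mul (by positivity), ENNReal.ofReal_le_iff_le_toReal hω.ne] at h1
  have h2 : |Δ n k ω| ^ p ≤ ((S ω).toReal ^ p⁻¹ * (2 ^ (-κ)) ^ n) ^ p := by
    rw [Real.mul_rpow (by positivity) (by positivity), Real.rpow_inv_rpow ENNReal.toReal_nonneg
      hp.ne']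
    have h3 : (((2 : ℝ) ^ (-κ)) ^ n) ^ p = (b ^ n)⁻¹ := by
      rw [hb, ← Real.rpow_natCast, ← Real.rpow_natCast, ← Real.rpow_mul (by positivity),
        ← Real.rpow_mul (by positivity), ← Real.rpow_mul (by positivity),
        ← Real.rpow_neg (by positivity)]
      ring_nf
    rw [h3, ← div_eq_mul_inv, le_div_iff₀ (by positivity)]
    linarith
  exact (Real.rpow_le_rpow_iff (abs_nonneg _) (by positivity) hp).1 h2

/-- **Kolmogorov–Chentsov theorem** for processes that satisfy the moment condition for every
Hölder exponent below `r`. -/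
theorem hasHolderTrajectories_of_moment_bound {Y : ℝ≥0 → Ω → ℝ} (hT : 0 < T)
    (hY : ∀ t ≤ T, AEMeasurable (Y t) P) {r : ℝ} (hr : 0 < r)
    (h : ∀ κ : ℝ, 0 < κ → κ < r → ∃ p θ C : ℝ, 0 < p ∧ 1 + p * κ < θ ∧ 0 ≤ C ∧
      ∀ s t : ℝ≥0, s < t → t ≤ T →
        ∫⁻ ω, ENNReal.ofReal (|Y t ω - Y s ω| ^ p) ∂P ≤
          ENNReal.ofReal (C * ((t : ℝ) - s) ^ θ)) :
    HasHolderTrajectories P T Y r := by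
  classical
  have hT' : (0 : ℝ) < T := by exact_mod_cast hT
  -- Measurable versions are needed for the limits below to be measurable; the value `0` beyond `T`
  -- only makes `W` total.
  set W : ℝ≥0 → Ω → ℝ := fun t => if ht : t ≤ T then (hY t ht).mk (Y t) else 0 with hWdef
  have hWm : ∀ t, Measurable (W t) := by
    intro t
    simp only [hWdef]
    split_ifs with ht
    · exact (hY t ht).measurable_mk
    · exact measurable_zero
  have hWY : ∀ t ≤ T, W t =ᵐ[P] Y t := by
    intro t ht
    simp only [hWdef, dif_pos ht]
    exact (hY t ht).ae_eq_mk.symm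
  have hWmom : ∀ κ : ℝ, 0 < κ → κ < r → ∃ p θ C : ℝ, 0 < p ∧ 1 + p * κ < θ ∧ 0 ≤ C ∧
      ∀ s t : ℝ≥0, s < t → t ≤ T →
        ∫⁻ ω, ENNReal.ofReal (|W t ω - W s ω| ^ p) ∂P ≤
          ENNReal.ofReal (C * ((t : ℝ) - s) ^ θ) := by
    intro κ hκ hκr
    obtain ⟨p, θ, C, hp, hθ, hC, hb⟩ := h κ hκ hκr
    refine ⟨p, θ, C, hp, hθ, hC, fun s t hst htT => le_trans (le_of_eq ?_) (hb s t hst htT)⟩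
    refine lintegral_congr_ae ?_
    filter_upwards [hWY t htT, hWY s (hst.le.trans htT)] with ω h1 h2
    rw [h1, h2]
  set good : Ω → Prop := fun ω => ∀ κ : ℝ, 0 < κ → κ < r → ∃ M : ℝ, 0 ≤ M ∧
    ∀ n k : ℕ, k < 2 ^ n →
      |W ((k + 1 : ℕ) * T / 2 ^ n) ω - W (k * T / 2 ^ n) ω| ≤ M * (2 ^ (-κ)) ^ n with hgood
  have hgood_ae : ∀ᵐ ω ∂P, good ω := by
    -- A single null set must serve all `κ < r`; the exponents `r - r / (j + 2)` increase to `r`,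
    -- and the bound for a larger exponent implies it for a smaller one.
    have hseq : ∀ j : ℕ, ∀ᵐ ω ∂P, ∃ M : ℝ, 0 ≤ M ∧ ∀ n k : ℕ, k < 2 ^ n →
        |W ((k + 1 : ℕ) * T / 2 ^ n) ω - W (k * T / 2 ^ n) ω| ≤
          M * (2 ^ (-(r - r / (j + 2)))) ^ n := by
      intro j
      have h2 : (1 : ℝ) < (j : ℝ) + 2 := by linarith [(Nat.cast_nonneg j : (0 : ℝ) ≤ j)]
      obtain ⟨p, θ, C, hp, hθ, hC, hb⟩ := hWmom (r - r / (j + 2))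
        (sub_pos.2 (div_lt_self hr h2)) (sub_lt_self _ (by positivity))
      exact ae_exists_dyadic_bound hT hWm hp hθ hC hb
    filter_upwards [ae_all_iff.2 hseq] with ω hω κ hκ hκr
    obtain ⟨j, hj⟩ := exists_nat_gt (r / (r - κ))
    have hrκ : 0 < r - κ := sub_pos.2 hκr
    have hj2 : κ ≤ r - r / (j + 2) := by
      rw [div_lt_iff₀ hrκ] at hj
      have : r / (j + 2) ≤ r - κ := by
        rw [div_le_iff₀ (by positivity)]
        linarith
      linarith
    obtain ⟨M, hM, hb⟩ := hω j
    refine ⟨M, hM, fun n k hk => (hb n k hk).trans ?_⟩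
    gcongr
    norm_num
  set N : Set Ω := toMeasurable P {ω | ¬ good ω} with hN
  have hNm : MeasurableSet N := measurableSet_toMeasurable _ _
  have hN0 : P N = 0 := by
    rw [hN, measure_toMeasurable]
    exact hgood_ae
  have hNgood : ∀ ω ∉ N, good ω := by
    intro ω hω
    by_contra hc
    exact hω (subset_toMeasurable _ _ hc)
  set F : Ω → ℕ → ℕ → ℝ := fun ω n k => W (k * T / 2 ^ n) ω with hF
  have hFc : ∀ ω n k, F ω (n + 1) (2 * k) = F ω n k := by
    intro ω n k
    simp only [hF]
    congr 1
    rw [pow_succ, mul_comm (2 ^ n : ℝ≥0) 2, Nat.cast_mul, mul_assoc]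
    exact mul_div_mul_left _ _ two_ne_zero
  have hlim : ∀ ω ∉ N, ∀ x : ℝ, 0 ≤ x → x ≤ 1 →
      ∃ l, Tendsto (fun n => F ω n ⌊2 ^ n * x⌋₊) atTop (𝓝 l) := by
    intro ω hω x hx hx1
    obtain ⟨M, hM, hb⟩ := hNgood ω hω (r / 2) (half_pos hr) (half_lt_self hr)
    exact exists_tendsto_dyadic (half_pos hr) (hFc ω) hM hb hx hx1
  set L : Ω → ℝ → ℝ := fun ω x => limUnder atTop (fun n => F ω n ⌊2 ^ n * x⌋₊) with hL
  have hLlim : ∀ ω ∉ N, ∀ x : ℝ, 0 ≤ x → x ≤ 1 →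
      Tendsto (fun n => F ω n ⌊2 ^ n * x⌋₊) atTop (𝓝 (L ω x)) :=
    fun ω hω x hx hx1 => tendsto_nhds_limUnder (hlim ω hω x hx hx1)
  have hdiv : ∀ t : ℝ≥0, t ≤ T → 0 ≤ (t : ℝ) / T ∧ (t : ℝ) / T ≤ 1 := fun t ht =>
    ⟨by positivity, (div_le_one hT').2 (by exact_mod_cast ht)⟩
  have hlim' : ∀ t ≤ T, ∀ ω, Tendsto (fun n : ℕ =>
      Nᶜ.indicator (fun ω => F ω n ⌊2 ^ n * ((t : ℝ) / T)⌋₊) ω) atTop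
      (𝓝 (Nᶜ.indicator (fun ω => L ω ((t : ℝ) / T)) ω)) := by
    intro t ht ω
    by_cases hω : ω ∈ N
    · simp [hω]
    · simp only [indicator_of_mem (mem_compl hω)]
      exact hLlim ω hω _ (hdiv t ht).1 (hdiv t ht).2
  refine ⟨fun t => Nᶜ.indicator fun ω => L ω ((t : ℝ) / T), fun t ht => ⟨?_, ?_⟩, ?_⟩
  · refine measurable_of_tendsto_metrizable (f := fun n : ℕ =>
      Nᶜ.indicator (fun ω => F ω n ⌊2 ^ n * ((t : ℝ) / T)⌋₊)) (fun n => ?_)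
      (tendsto_pi_nhds.2 (hlim' t ht))
    exact (hWm _).indicator hNm.compl
  · refine EventuallyEq.trans ?_ (hWY t ht)
    obtain ⟨p, θ, C, hp, hθ, hC, hb⟩ := hWmom (r / 2) (half_pos hr) (half_lt_self hr)
    have hθ0 : 0 < θ := by
      have : 0 < p * (r / 2) := by positivity
      linarith
    set V : Ω → ℝ := Nᶜ.indicator fun ω => L ω ((t : ℝ) / T)
    have hbound : ∀ n : ℕ,
        ∫⁻ ω, ENNReal.ofReal (|W t ω - F ω n ⌊2 ^ n * ((t : ℝ) / T)⌋₊| ^ p) ∂P ≤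
          ENNReal.ofReal (C * ((T : ℝ) / 2 ^ n) ^ θ) := by
      intro n
      set k := ⌊(2 : ℝ) ^ n * ((t : ℝ) / T)⌋₊ with hk
      have hpos2 : (0 : ℝ) < 2 ^ n := by positivity
      have h1 : (k : ℝ) ≤ 2 ^ n * ((t : ℝ) / T) :=
        Nat.floor_le (mul_nonneg hpos2.le (hdiv t ht).1)
      have h2 : 2 ^ n * ((t : ℝ) / T) < k + 1 := Nat.lt_floor_add_one _
      have h3 : (k : ℝ) * T / 2 ^ n ≤ t := by
        rw [div_le_iff₀ hpos2]
        rw [mul_div_assoc', le_div_iff₀ hT'] at h1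
        linarith
      have h4 : (t : ℝ) - k * T / 2 ^ n ≤ T / 2 ^ n := by
        rw [mul_div_assoc', div_lt_iff₀ hT'] at h2
        rw [sub_le_iff_le_add, ← add_div, le_div_iff₀ hpos2]
        linarith
      have h3' : (k * T / 2 ^ n : ℝ≥0) ≤ t := by exact_mod_cast h3
      rcases h3'.eq_or_lt with h5 | h5
      · simp only [hF, h5, sub_self, abs_zero, Real.zero_rpow hp.ne', ENNReal.ofReal_zero,
          lintegral_zero]
        exact zero_le
      · refine (hb _ t h5 ht).trans (ENNReal.ofReal_le_ofReal ?_)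
        push_cast
        gcongr
    -- The dyadic times below `t` are within `T / 2^n` of it, so their values tend to `W t` in
    -- `p`-th mean and, off `N`, to `V`; Fatou identifies the limits.
    have hzero : ∫⁻ ω, ENNReal.ofReal (|W t ω - V ω| ^ p) ∂P = 0 := by
      refine le_antisymm ?_ zero_le
      calc ∫⁻ ω, ENNReal.ofReal (|W t ω - V ω| ^ p) ∂P
          = ∫⁻ ω, liminf (fun n : ℕ => ENNReal.ofReal
              (|W t ω - F ω n ⌊2 ^ n * ((t : ℝ) / T)⌋₊| ^ p)) atTop ∂P := by
            refine lintegral_congr_ae ?_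
            filter_upwards [measure_eq_zero_iff_ae_notMem.1 hN0] with ω hω
            refine (Tendsto.liminf_eq ?_).symm
            have h1 := hlim' t ht ω
            simp only [indicator_of_mem (mem_compl hω)] at h1
            have h2 : V ω = L ω ((t : ℝ) / T) := indicator_of_mem (mem_compl hω) _
            rw [h2]
            exact (ENNReal.continuous_ofReal.tendsto _).comp
              ((h1.const_sub (W t ω)).abs.rpow_const (Or.inr hp.le))
        _ ≤ liminf (fun n : ℕ => ∫⁻ ω, ENNReal.ofReal
              (|W t ω - F ω n ⌊2 ^ n * ((t : ℝ) / T)⌋₊| ^ p) ∂P) atTop := by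
            refine lintegral_liminf_le fun n => ?_
            exact ENNReal.measurable_ofReal.comp (((hWm _).sub (hWm _)).abs.pow_const p)
        _ ≤ liminf (fun n : ℕ => ENNReal.ofReal (C * ((T : ℝ) / 2 ^ n) ^ θ)) atTop :=
            liminf_le_liminf (Eventually.of_forall hbound)
        _ = 0 := by
            refine Tendsto.liminf_eq ?_
            have h1 : Tendsto (fun n : ℕ => (T : ℝ) / 2 ^ n) atTop (𝓝 0) := by
              have := (tendsto_pow_atTop_nhds_zero_of_lt_one (r := (1 / 2 : ℝ)) (by norm_num)
                (by norm_num)).const_mul (T : ℝ)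
              simpa [div_eq_mul_inv] using this
            have h2 := (h1.rpow_const (p := θ) (Or.inr hθ0.le)).const_mul C
            rw [Real.zero_rpow hθ0.ne', mul_zero] at h2
            have h3 := (ENNReal.continuous_ofReal.tendsto _).comp h2
            rw [ENNReal.ofReal_zero] at h3
            exact h3
    have hVm : Measurable V := measurable_of_tendsto_metrizable (f := fun n : ℕ =>
      Nᶜ.indicator (fun ω => F ω n ⌊2 ^ n * ((t : ℝ) / T)⌋₊))
      (fun n => (hWm _).indicator hNm.compl) (tendsto_pi_nhds.2 (hlim' t ht))
    have hm : Measurable (fun ω => ENNReal.ofReal (|W t ω - V ω| ^ p)) :=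
      ENNReal.measurable_ofReal.comp (((hWm t).sub hVm).abs.pow_const p)
    rw [lintegral_eq_zero_iff hm] at hzero
    filter_upwards [hzero] with ω hω
    have h1 : |W t ω - V ω| ^ p ≤ 0 := by simpa using hω
    have h2 : |W t ω - V ω| ^ p = 0 := le_antisymm h1 (by positivity)
    rw [Real.rpow_eq_zero (abs_nonneg _) hp.ne', abs_eq_zero, sub_eq_zero] at h2
    exact h2.symm
  · intro ω κ hκ hκr
    by_cases hω : ω ∈ N
    · refine ⟨0, holderOnWith_of_abs_sub_le fun x _ y _ _ => ?_⟩
      simp [hω]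
    · obtain ⟨M, hM, hb⟩ := hNgood ω hω κ (by exact_mod_cast hκ) hκr
      have hκ' : (0 : ℝ) < κ := by exact_mod_cast hκ
      have hρ : (2 : ℝ) ^ (-(κ : ℝ)) < 1 :=
        Real.rpow_lt_one_of_one_lt_of_neg (by norm_num) (by linarith)
      have hρ' : 0 < 1 - (2 : ℝ) ^ (-(κ : ℝ)) := sub_pos.2 hρ
      set B : ℝ := M * (1 + 2 / (1 - 2 ^ (-(κ : ℝ)))) * 2 ^ (κ : ℝ) with hB
      have hB0 : 0 ≤ B := by positivity
      -- The dyadic estimate lives in the rescaled time `t / T`, hence the factor `T^{-κ}`.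
      refine ⟨⟨B / (T : ℝ) ^ (κ : ℝ), by positivity⟩,
        holderOnWith_of_abs_sub_le fun x hx y hy hxy => ?_⟩
      simp only [indicator_of_mem (mem_compl hω)]
      have hxy' : (x : ℝ) ≤ y := by exact_mod_cast hxy
      have h1 := abs_sub_le_of_tendsto_dyadic hκ' (hFc ω) hM hb (hLlim ω hω) (hdiv x hx.2).1
        (by gcongr : (x : ℝ) / T ≤ (y : ℝ) / T) (hdiv y hy.2).2
      refine h1.trans_eq ?_
      rw [← sub_div, Real.div_rpow (sub_nonneg.2 hxy') hT'.le]
      change B * _ = B / (T : ℝ) ^ (κ : ℝ) * _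
      ring

end Kolmogorov

/-! ### Moments of centered Gaussian laws -/

lemma integrable_abs_rpow_gaussianReal (v : ℝ≥0) {p : ℝ} (hp : 0 < p) :
    Integrable (fun x => |x| ^ p) (gaussianReal 0 v) := by
  have h := (memLp_id_gaussianReal (μ := 0) (v := v) p.toNNReal).integrable_norm_rpow'
  simpa [hp.le] using h

/-- The law with variance `v` is the image of the standard one under multiplication by `√v`,
including `v = 0`. -/
lemma integral_abs_rpow_gaussianReal (v : ℝ≥0) (p : ℝ) :
    ∫ x, |x| ^ p ∂(gaussianReal 0 v) = √v ^ p * ∫ x, |x| ^ p ∂(gaussianReal 0 1) := by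
  have h1 : gaussianReal 0 v = (gaussianReal 0 1).map (√(v : ℝ) * ·) := by
    rw [gaussianReal_map_const_mul, mul_zero, mul_one]
    congr 1
    ext
    exact (Real.sq_sqrt v.2).symm
  have h2 : Measurable fun x : ℝ => |x| ^ p := measurable_id.abs.pow_const p
  rw [h1, integral_map (by fun_prop) h2.aestronglyMeasurable, ← integral_const_mul]
  refine integral_congr_ae (ae_of_all _ fun x => ?_)
  simp only
  rw [abs_mul, abs_of_nonneg (Real.sqrt_nonneg _),
    Real.mul_rpow (Real.sqrt_nonneg _) (abs_nonneg _)]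

/-! ### Volterra processes with the Molchan–Golosov kernel -/

section

variable {Ω : Type*} [MeasurableSpace Ω] {P : Measure Ω} {Z : ℝ≥0 → Ω → ℝ} {T : ℝ≥0} {H c : ℝ}

lemma HasIncrementExponent.exists_isVolterraProcess [IsProbabilityMeasure P] {ψ : ℝ → ℝ} {σ : ℝ}
    (hZ : HasIncrementExponent Z P ψ σ) (T : ℝ≥0) (hc : 0 < c) (hH : H ∈ Ioo (0 : ℝ) 1) :
    ∃ Y : ℝ≥0 → Ω → ℝ, IsVolterraProcess Z P T (molchanGolosovKernel c H) Y := by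
  choose Y hY1 hY2 using fun t =>
    hZ.exists_isStochasticIntegral (memLp_molchanGolosovKernel hc hH t)
  exact ⟨Y, fun t _ => hY1 t, fun t _ => hY2 t⟩

/-- `Y s` is read as an integral over `[0, t]` of its kernel extended by zero, which makes the
increment a single integral. -/
lemma IsVolterraProcess.isStochasticIntegral_increment {g : ℝ → ℝ → ℝ} {Y : ℝ≥0 → Ω → ℝ}
    (hY : IsVolterraProcess Z P T g Y) {s t : ℝ≥0} (hst : s ≤ t) (ht : t ≤ T) :
    IsStochasticIntegral Z P t (fun u => g t u - (Icc (0 : ℝ) s).indicator (g s) u)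
      (fun ω => Y t ω - Y s ω) :=
  (hY.isStochasticIntegral t ht).sub ((hY.isStochasticIntegral s (hst.trans ht)).extend hst)

lemma HasIncrementExponent.exists_lintegral_increment_sq_le [IsProbabilityMeasure P] {ψ : ℝ → ℝ}
    {σ : ℝ} (hZ : HasIncrementExponent Z P ψ σ) (hT : 0 < T) (hc : 0 < c)
    (hH : H ∈ Ioo (0 : ℝ) 1) {Y : ℝ≥0 → Ω → ℝ}
    (hY : IsVolterraProcess Z P T (molchanGolosovKernel c H) Y) {θ : ℝ} (hθ : 0 < θ)
    (hθH : θ < H) :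
    ∃ C : ℝ, 0 < C ∧ ∀ s t : ℝ≥0, s < t → t ≤ T →
      ∫⁻ ω, ENNReal.ofReal ((Y t ω - Y s ω) ^ 2) ∂P ≤
        ENNReal.ofReal (C * ((t : ℝ) - s) ^ (2 * θ)) := by
  obtain ⟨C, hC, h⟩ := exists_integral_molchanGolosovKernel_increment_sq_le hc hH hT hθ hθH
  have hσ := hZ.sigma_nonneg
  refine ⟨2 * (σ * C) + 1, by positivity, fun s t hst ht => ?_⟩
  obtain ⟨hmem, hle⟩ := h s t hst ht
  refine (hZ.lintegral_sq_le hmem (hY.isStochasticIntegral_increment hst.le ht)).trans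
    (ENNReal.ofReal_le_ofReal ?_)
  have hst' : (0 : ℝ) ≤ (t : ℝ) - s := sub_nonneg.2 (by exact_mod_cast hst.le)
  have hpos : 0 ≤ ((t : ℝ) - s) ^ (2 * θ) := by positivity
  have := mul_le_mul_of_nonneg_left hle hσ
  linarith

/-- The increment is centered Gaussian with variance `v ≤ C (t - s)^{2θ}`, so its `p`-th absolute
moment is `√v ^ p` times the standard one. -/
lemma ProbabilityTheory.IsPreBrownianReal.exists_integral_increment_rpow_le
    [IsProbabilityMeasure P] (hZ : IsPreBrownianReal Z P) (hT : 0 < T) (hc : 0 < c)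
    (hH : H ∈ Ioo (0 : ℝ) 1) {Y : ℝ≥0 → Ω → ℝ}
    (hY : IsVolterraProcess Z P T (molchanGolosovKernel c H) Y) {θ : ℝ} (hθ : 0 < θ)
    (hθH : θ < H) {p : ℝ} (hp : 0 < p) :
    ∃ C : ℝ, 0 < C ∧ ∀ s t : ℝ≥0, s < t → t ≤ T →
      Integrable (fun ω => |Y t ω - Y s ω| ^ p) P ∧
      ∫ ω, |Y t ω - Y s ω| ^ p ∂P ≤ C * ((t : ℝ) - s) ^ (p * θ) := by
  obtain ⟨C, hC, h⟩ := exists_integral_molchanGolosovKernel_increment_sq_le hc hH hT hθ hθH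
  set m := ∫ x, |x| ^ p ∂(gaussianReal 0 1)
  have hm : 0 ≤ m := integral_nonneg fun x => by positivity
  refine ⟨√C ^ p * m + 1, by positivity, fun s t hst ht => ?_⟩
  obtain ⟨hmem, hle⟩ := h s t hst ht
  have hst' : (0 : ℝ) ≤ (t : ℝ) - s := sub_nonneg.2 (by exact_mod_cast hst.le)
  have hYm : AEMeasurable (fun ω => Y t ω - Y s ω) P :=
    (hY.aemeasurable t ht).sub (hY.aemeasurable s (hst.le.trans ht))
  have hlaw := hZ.hasIncrementExponent.map_eq_gaussianReal hmem
    (hY.isStochasticIntegral_increment hst.le ht)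
  set v := ∫ u in Icc (0 : ℝ) t, (molchanGolosovKernel c H t u -
    (Icc (0 : ℝ) s).indicator (molchanGolosovKernel c H s) u) ^ 2
  have hv : 0 ≤ v := integral_nonneg fun u => sq_nonneg _
  have hmeas : AEStronglyMeasurable (fun x : ℝ => |x| ^ p)
      (P.map fun ω => Y t ω - Y s ω) :=
    (measurable_id.abs.pow_const p).aestronglyMeasurable
  constructor
  · have h1 := integrable_abs_rpow_gaussianReal v.toNNReal hp
    rw [← hlaw] at h1
    exact (integrable_map_measure hmeas hYm).1 h1
  · have h1 := integral_map hYm hmeas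
    rw [hlaw, integral_abs_rpow_gaussianReal, Real.coe_toNNReal _ hv] at h1
    rw [← h1]
    have h2 : √v ≤ √C * ((t : ℝ) - s) ^ θ := by
      refine Real.sqrt_le_left (by positivity) |>.2 ?_
      rw [mul_pow, Real.sq_sqrt hC.le, ← Real.rpow_mul_natCast hst']
      refine hle.trans_eq ?_
      push_cast
      ring_nf
    calc √v ^ p * m ≤ (√C * ((t : ℝ) - s) ^ θ) ^ p * m := by gcongr
      _ = (√C ^ p * m) * ((t : ℝ) - s) ^ (p * θ) := by
        rw [Real.mul_rpow (by positivity) (by positivity), ← Real.rpow_mul hst', mul_comm θ p]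
        ring
      _ ≤ (√C ^ p * m + 1) * ((t : ℝ) - s) ^ (p * θ) := by
        gcongr
        linarith

end

/-! ### Assembly of the Lévy and the Brownian case -/

theorem propositionp {Ω : Type*} [MeasurableSpace Ω] (P : Measure Ω) [IsProbabilityMeasure P]
    (T : ℝ≥0) (hT : 0 < T) (H ε c : ℝ) (hH : H ∈ Ioo (0 : ℝ) 1) (hε : ε ∈ Ioo (0 : ℝ) H)
    (hc : 0 < c) :
    -- Part 1: a Lévy base process
    (∀ (Z : ℝ≥0 → Ω → ℝ) (a : ℝ) (π : Measure ℝ),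
      IsLevyProcess Z P → HasCharacteristicTriplet Z P a 0 π →
      π.map (fun x => -x) = π →
      0 < ∫⁻ x, ENNReal.ofReal (x ^ 2) ∂π → ∫⁻ x, ENNReal.ofReal (x ^ 2) ∂π < ∞ →
      (∃ Y : ℝ≥0 → Ω → ℝ, IsVolterraProcess Z P T (molchanGolosovKernel c H) Y) ∧
      ∀ Y : ℝ≥0 → Ω → ℝ, IsVolterraProcess Z P T (molchanGolosovKernel c H) Y →
        (∃ C : ℝ, 0 < C ∧ ∀ s t : ℝ≥0, s < t → t ≤ T →
          Integrable (fun ω => |Y t ω - Y s ω| ^ 2) P ∧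
          ∫ ω, |Y t ω - Y s ω| ^ 2 ∂P ≤ C * ((t : ℝ) - s) ^ (2 * (H - ε))) ∧
        (1 / 2 < H → HasHolderTrajectories P T Y (H - 1 / 2))) ∧
    -- Part 2: a Brownian motion as base process
    (∀ Z : ℝ≥0 → Ω → ℝ, IsBrownianReal Z P →
      (∃ Y : ℝ≥0 → Ω → ℝ, IsVolterraProcess Z P T (molchanGolosovKernel c H) Y) ∧
      ∀ Y : ℝ≥0 → Ω → ℝ, IsVolterraProcess Z P T (molchanGolosovKernel c H) Y →
        (∀ p : ℝ, 2 ≤ p → ∃ C : ℝ, 0 < C ∧ ∀ s t : ℝ≥0, s < t → t ≤ T →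
          Integrable (fun ω => |Y t ω - Y s ω| ^ p) P ∧
          ∫ ω, |Y t ω - Y s ω| ^ p ∂P ≤ C * ((t : ℝ) - s) ^ (p * (H - ε))) ∧
        HasHolderTrajectories P T Y H) := by
  have hHε : 0 < H - ε := sub_pos.2 hε.2
  have hHε' : H - ε < H := sub_lt_self H hε.1
  refine ⟨fun Z a π hZ hchar hπ _ hfin => ?_, fun Z hZ => ?_⟩
  · have hexp := hZ.hasIncrementExponent hchar hπ hfin
    refine ⟨hexp.exists_isVolterraProcess T hc hH, fun Y hY => ⟨?_, fun hH2 => ?_⟩⟩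
    · obtain ⟨C, hC, h⟩ := hexp.exists_lintegral_increment_sq_le hT hc hH hY hHε hHε'
      refine ⟨C, hC, fun s t hst ht => ?_⟩
      have hst' : (0 : ℝ) ≤ (t : ℝ) - s := sub_nonneg.2 (by exact_mod_cast hst.le)
      have hle := h s t hst ht
      have hYm : AEStronglyMeasurable (fun ω => Y t ω - Y s ω) P :=
        ((hY.aemeasurable t ht).sub (hY.aemeasurable s (hst.le.trans ht))).aestronglyMeasurable
      have hint := (memLp_two_of_lintegral_sq hYm
        (hle.trans_lt ENNReal.ofReal_lt_top)).integrable_sq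
      simp only [sq_abs]
      refine ⟨hint, ?_⟩
      rw [← ofReal_integral_eq_lintegral_ofReal hint (ae_of_all _ fun ω => sq_nonneg _)] at hle
      exact (ENNReal.ofReal_le_ofReal_iff (by positivity)).1 hle
    · refine hasHolderTrajectories_of_moment_bound hT hY.aemeasurable (sub_pos.2 hH2)
        fun κ hκ hκH => ?_
      -- With `p = 2` the moment exponent is `2θ`, and `1 + 2κ < 2θ` means `θ > κ + 1/2`.
      obtain ⟨θ, hθ, hθH⟩ := exists_between (show κ + 1 / 2 < H by linarith)
      obtain ⟨C, hC, h⟩ := hexp.exists_lintegral_increment_sq_le hT hc hH hY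
        (show 0 < θ by linarith) hθH
      refine ⟨2, 2 * θ, C, by norm_num, by linarith, hC.le, fun s t hst ht => ?_⟩
      simpa only [Real.rpow_ofNat, sq_abs] using h s t hst ht
  · refine ⟨hZ.hasIncrementExponent.exists_isVolterraProcess T hc hH,
      fun Y hY => ⟨fun p hp => ?_, ?_⟩⟩
    · exact hZ.exists_integral_increment_rpow_le hT hc hH hY hHε hHε' (by linarith)
    · refine hasHolderTrajectories_of_moment_bound hT hY.aemeasurable hH.1 fun κ hκ hκH => ?_
      obtain ⟨θ, hθ, hθH⟩ := exists_between hκH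
      have hθκ : 0 < θ - κ := sub_pos.2 hθ
      -- The moment order `p = 2 / (θ - κ)` gives `pθ - pκ = 2 > 1`, as Kolmogorov's criterion
      -- requires.
      have hp : 0 < 2 / (θ - κ) := by positivity
      obtain ⟨C, hC, h⟩ := hZ.exists_integral_increment_rpow_le hT hc hH hY
        (hκ.trans hθ) hθH hp
      refine ⟨2 / (θ - κ), 2 / (θ - κ) * θ, C, hp, ?_, hC.le, fun s t hst ht => ?_⟩
      · have h1 : 2 / (θ - κ) * θ - 2 / (θ - κ) * κ = 2 := by
          rw [← mul_sub, div_mul_cancel₀ _ hθκ.ne']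
        linarith
      · obtain ⟨h1, h2⟩ := h s t hst ht
        rw [← ofReal_integral_eq_lintegral_ofReal h1 (ae_of_all _ fun ω => by positivity)]
        exact ENNReal.ofReal_le_ofReal h2
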